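/- Let $\mathbb{F}$ be an arbitrary field, let $V$ be an infinite-dimensional vector space over $\mathbb{F}$, and let $u$ be an endomorphism of $V$. Suppose that $u$ has no dominant eigenvalue, i.e. that there is no scalar $\lambda\in\mathbb{F}$ with $\operatorname{rk}(u-\lambda\,\mathrm{id}_V)<\dim V$ (rank and dimension being cardinal numbers). Let $p_1,p_2,p_3\in\mathbb{F}[t]$ be polynomials of degree $2$ that split over $\mathbb{F}$. Then $u$ is a $(p_1,p_2,p_3)$-sum, i.e. there exist endomorphisms $u_1,u_2,u_3$ of $V$ such that $u=u_1+u_2+u_3$ and $p_k(u_k)=0$ for every $k\in\{1,2,3\}$. -/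

import Mathlib

open Polynomial

/-- The scalar `l` is a dominant eigenvalue of the endomorphism `u` of `V`:
`rk (u - l id) < dim V`, as cardinals. -/
def IsDominantEigenvalue {F V : Type*} [Field F] [AddCommGroup V] [Module F V]
    (u : Module.End F V) (l : F) : Prop :=
  LinearMap.rank (u - l • (LinearMap.id : V →ₗ[F] V)) < Module.rank F V

/-- The endomorphism `u` is a `(p 0, ..., p (n - 1))`-sum: it is the sum of endomorphisms
`w 0, ..., w (n - 1)` such that `p k` annihilates `w k` for every `k`. -/
def IsPolynomialSum {F V : Type*} [Field F] [AddCommGroup V] [Module F V] {n : ℕ}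
    (p : Fin n → F[X]) (u : Module.End F V) : Prop :=
  ∃ w : Fin n → Module.End F V, u = ∑ k, w k ∧ ∀ k, aeval (w k) (p k) = 0

/-! Translating each summand by a root of its polynomial reduces everything to polynomials `X (X -
a)`, `X (X - b)`, `X (X - c)`. It is then enough to find `f` with `f ^ 2 = a f` such that `w = u -
f` turns the space into a free `F[X]`-module. Indeed, in each free cyclic summand generated by `v`,
apply to `v` the Newton products whose roots are alternately `c` and `b`: in this basis `w` sends `e
n` to `e (n + 1)` plus `c` or `b` times `e n`. Collecting the even columns into `h` and the odd ones
into `g` gives `w = g + h` with `h ^ 2 = c h` and `g ^ 2 = b g` (`exists_add_of_basis`).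

Freeness is obtained along a well-ordered chain of `u`-invariant subspaces. If on every section of
the chain some quadratic `f` makes `u - f` cyclic with infinite-dimensional orbit, then linear
complements lift these maps to one global `f`, and the sections, being free, split
(`exists_basis_of_chain`, `isQuadraticSum_of_chain`).

A single section is built by finite stages (`IsStage`): `f` is known on a finite-dimensional Krylov
space `U` of `u - f`, and `U` is not `u`-invariant. The space grows either by following `u`
(`exists_advance`), or, when the orbit closes up, by letting `f` jump to a fresh vector `x` that is
not an eigenvector modulo what is already built (`exists_connect`), or by a detour through a
prescribed vector (`exists_insert`).

The supply of fresh vectors depends on `u`. In uncountable dimension, what is built before each step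
is smaller than `V`, so `u` is still not scalar modulo it. In countable dimension there are three
cases. If `u` is algebraic, half of the non-scalar behaviour is kept in reserve at each step, so
that the quotients stay non-scalar. If `u` is torsion but not algebraic, vectors with long orbits
exist modulo every finite-dimensional invariant subspace, and one section suffices. If `u` is not
torsion, all but one member of a maximal `F[X]`-independent family give sections with `f = 0`, and
the last one absorbs all remaining torsion. -/

/-! ### Finite stages: Krylov spaces of `u - f` and two ways to enlarge them. -/

section Krylov

variable {F M : Type*} [Field F] [AddCommGroup M] [Module F M]

/-- The successive spans `span {v, w v, ..., w ^ n v}`. -/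
inductive KrylovChain (w : Module.End F M) (v : M) : Submodule F M → Prop
  | base : KrylovChain w v (Submodule.span F {v})
  | step {U : Submodule F M} : KrylovChain w v U → KrylovChain w v (U ⊔ U.map w)

namespace KrylovChain

variable {w w' : Module.End F M} {v : M} {U : Submodule F M}

theorem mem (h : KrylovChain w v U) : v ∈ U := by
  induction h with
  | base => exact Submodule.mem_span_singleton_self v
  | step _ ih => exact Submodule.mem_sup_left ih

theorem fg (h : KrylovChain w v U) : U.FG := by
  induction h with
  | base => exact Submodule.fg_span_singleton v
  | step _ ih => exact ih.sup (ih.map w)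

/-- If passing from `U` to `U + w U` adds only `q`, then the following passage adds only `w q`,
because `w U` is already inside. -/
theorem exists_sup_map_eq (h : KrylovChain w v U) :
    ∃ q, U ⊔ U.map w = U ⊔ Submodule.span F {q} := by
  induction h with
  | base => exact ⟨w v, by rw [Submodule.map_span, Set.image_singleton]⟩
  | @step U _ ih =>
    obtain ⟨q, hq⟩ := ih
    refine ⟨w q, ?_⟩
    conv_lhs => rw [hq, Submodule.map_sup, Submodule.map_span, Set.image_singleton, ← hq]
    rw [← sup_assoc, sup_assoc U, sup_idem]

theorem congr (h : KrylovChain w v U) (hw : ∀ z ∈ U, w' z = w z) : KrylovChain w' v U := by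
  induction h with
  | base => exact base
  | @step U _ ih =>
    have h1 : ∀ z ∈ U, w' z = w z := fun z hz => hw z (Submodule.mem_sup_left hz)
    have h2 : U.map w = U.map w' := by
      ext x
      simp only [Submodule.mem_map]
      exact ⟨fun ⟨y, hy, e⟩ => ⟨y, hy, (h1 y hy).trans e⟩,
        fun ⟨y, hy, e⟩ => ⟨y, hy, (h1 y hy).symm.trans e⟩⟩
    rw [h2]
    exact step (ih h1)

theorem exists_aeval (h : KrylovChain w v U) : ∀ z ∈ U, ∃ p : F[X], z = aeval w p v := by
  induction h with
  | base =>
    intro z hz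
    obtain ⟨c, rfl⟩ := Submodule.mem_span_singleton.1 hz
    exact ⟨C c, by simp⟩
  | step _ ih =>
    intro z hz
    obtain ⟨x, hx, y, hy, rfl⟩ := Submodule.mem_sup.1 hz
    obtain ⟨t, ht, rfl⟩ := Submodule.mem_map.1 hy
    obtain ⟨p, rfl⟩ := ih x hx
    obtain ⟨q, rfl⟩ := ih t ht
    exact ⟨p + X * q, by simp⟩

end KrylovChain

theorem Submodule.exists_of_mem_sup_span_singleton {U : Submodule F M} {x z : M}
    (hz : z ∈ U ⊔ Submodule.span F {x}) : ∃ y ∈ U, ∃ c : F, y + c • x = z := by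
  obtain ⟨y, hy, t, ht, rfl⟩ := Submodule.mem_sup.1 hz
  obtain ⟨c, rfl⟩ := Submodule.mem_span_singleton.1 ht
  exact ⟨y, hy, c, rfl⟩

/-- Extending a linear map by a prescribed value outside of a subspace. -/
theorem exists_linearMap_eqOn_of_notMem (f : Module.End F M) {W : Submodule F M} {x : M}
    (hx : x ∉ W) (y : M) : ∃ g : Module.End F M, (∀ z ∈ W, g z = f z) ∧ g x = y := by
  obtain ⟨φ, h1, h2⟩ := Submodule.exists_le_ker_of_notMem hx
  refine ⟨f + (LinearMap.toSpanSingleton F M ((φ x)⁻¹ • (y - f x))).comp φ, ?_, ?_⟩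
  · intro z hz
    have : φ z = 0 := h2 hz
    simp [this]
  · simp [h1]

/-- Gluing linear maps along disjoint subspaces. -/
theorem exists_linearMap_eqOn_of_disjoint (f g : Module.End F M) {W E : Submodule F M}
    (h : Disjoint W E) :
    ∃ k : Module.End F M, (∀ z ∈ W, k z = f z) ∧ ∀ z ∈ E, k z = g z := by
  obtain ⟨C, hWC, hC⟩ := h.exists_isCompl
  refine ⟨LinearMap.ofIsCompl hC (f.domRestrict C) (g.domRestrict E), fun z hz => ?_,
    fun z hz => ?_⟩
  · exact LinearMap.ofIsCompl_apply_left hC ⟨z, hWC hz⟩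
  · exact LinearMap.ofIsCompl_apply_right hC ⟨z, hz⟩

/-- A finite stage of the construction of `f` with `f ^ 2 = a f` such that `u - f` is cyclic with
generator `v`: the map `f` matters only on the subspace `U`. -/
structure IsStage (u : Module.End F M) (a : F) (v : M) (f : Module.End F M)
    (U : Submodule F M) : Prop where
  chain : KrylovChain (u - f) v U
  mapsTo : ∀ z ∈ U, f z ∈ U
  quad : ∀ z ∈ U, f (f z) = a • f z
  not_inv : ¬ U.map u ≤ U

namespace IsStage

variable {u : Module.End F M} {a : F} {v : M} {f : Module.End F M} {U : Submodule F M}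

/-- As `f` preserves `U`, the maps `u` and `u - f` agree modulo `U`; the next Krylov space therefore
does not depend on `f`. -/
theorem sup_map_eq (h : IsStage u a v f U) : U ⊔ U.map (u - f) = U ⊔ U.map u := by
  apply le_antisymm
  · refine sup_le le_sup_left ?_
    rintro _ ⟨z, hz, rfl⟩
    exact sub_mem (Submodule.mem_sup_right (Submodule.mem_map_of_mem hz))
      (Submodule.mem_sup_left (h.mapsTo z hz))
  · refine sup_le le_sup_left ?_
    rintro _ ⟨z, hz, rfl⟩
    have : u z = (u - f) z + f z := by simp
    rw [this]
    exact add_mem (Submodule.mem_sup_right (Submodule.mem_map_of_mem hz))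
      (Submodule.mem_sup_left (h.mapsTo z hz))

/-- Non-invariance of `U` makes the next Krylov vector `q` new, so the value of `f` at `q` can still
be chosen freely. -/
theorem exists_next (h : IsStage u a v f U) :
    ∃ q, q ∉ U ∧ U ⊔ U.map u = U ⊔ Submodule.span F {q} := by
  obtain ⟨q, hq⟩ := h.chain.exists_sup_map_eq
  rw [h.sup_map_eq] at hq
  refine ⟨q, fun hqU => h.not_inv ?_, hq⟩
  rw [sup_eq_left.2 ((Submodule.span_singleton_le_iff_mem q U).2 hqU)] at hq
  exact sup_eq_left.1 hq

theorem chain_sup (h : IsStage u a v f U) {f' : Module.End F M} (hf : ∀ z ∈ U, f' z = f z) :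
    KrylovChain (u - f') v (U ⊔ U.map u) := by
  have h1 : KrylovChain (u - f') v U := h.chain.congr fun z hz => by simp [hf z hz]
  have h2 := h1.step
  have h3 : U.map (u - f') = U.map (u - f) := by
    ext x
    simp only [Submodule.mem_map]
    exact ⟨fun ⟨y, hy, e⟩ => ⟨y, hy, by rw [← e]; simp [hf y hy]⟩,
      fun ⟨y, hy, e⟩ => ⟨y, hy, by rw [← e]; simp [hf y hy]⟩⟩
  rwa [h3, h.sup_map_eq] at h2

/-- The value `f q = 0` is harmless as long as the enlarged space is itself not invariant. -/
theorem exists_advance (h : IsStage u a v f U) (hU : ¬ (U ⊔ U.map u).map u ≤ U ⊔ U.map u) :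
    ∃ f', (∀ z ∈ U, f' z = f z) ∧ IsStage u a v f' (U ⊔ U.map u) := by
  obtain ⟨q, hqU, hq⟩ := h.exists_next
  obtain ⟨f', h1, h2⟩ := exists_linearMap_eqOn_of_notMem f hqU 0
  refine ⟨f', h1, h.chain_sup h1, fun z hz => ?_, fun z hz => ?_, hU⟩
  all_goals
    rw [hq] at hz
    obtain ⟨x, hx, c, rfl⟩ := Submodule.exists_of_mem_sup_span_singleton hz
  · simp only [map_add, map_smul, h2, smul_zero, add_zero, h1 x hx]
    exact Submodule.mem_sup_left (h.mapsTo x hx)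
  · simp only [map_add, map_smul, h2, smul_zero, add_zero, h1 x hx, h1 _ (h.mapsTo x hx),
      h.quad x hx]

/-- The orbit has closed up, so `f` must leave the space. With `f q = a q - x` and `f x = 0` one
gets `f (f q) = a f q`, while `(u - f) q` equals `x` modulo the invariant space. The condition on `u
x` makes the new space non-invariant. -/
theorem exists_connect (h : IsStage u a v f U) (hU : (U ⊔ U.map u).map u ≤ U ⊔ U.map u)
    {x : M} (hx : u x ∉ (U ⊔ U.map u) ⊔ Submodule.span F {x}) :
    ∃ f', (∀ z ∈ U, f' z = f z) ∧
      IsStage u a v f' ((U ⊔ U.map u) ⊔ Submodule.span F {x}) := by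
  obtain ⟨q, hqU, hq⟩ := h.exists_next
  have hxS : x ∉ U ⊔ U.map u := fun hxS =>
    hx (Submodule.mem_sup_left (hU (Submodule.mem_map_of_mem hxS)))
  obtain ⟨f₁, h1, h2⟩ := exists_linearMap_eqOn_of_notMem f hqU (a • q - x)
  obtain ⟨f', h3, h4⟩ := exists_linearMap_eqOn_of_notMem f₁ hxS 0
  have hqS : q ∈ U ⊔ U.map u := hq ▸ Submodule.mem_sup_right (Submodule.mem_span_singleton_self q)
  have hf : ∀ z ∈ U, f' z = f z := fun z hz =>
    (h3 z (Submodule.mem_sup_left hz)).trans (h1 z hz)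
  have hfq : f' q = a • q - x := (h3 q hqS).trans h2
  refine ⟨f', hf, ?_, fun z hz => ?_, fun z hz => ?_, fun hinv => ?_⟩
  · have h5 := (h.chain_sup hf).step
    convert h5 using 1
    apply le_antisymm
    · refine sup_le le_sup_left ?_
      rw [Submodule.span_singleton_le_iff_mem]
      have : x = (u - f') q - (u q - a • q) := by simp [hfq]
      rw [this]
      exact sub_mem (Submodule.mem_sup_right (Submodule.mem_map_of_mem hqS))
        (Submodule.mem_sup_left (sub_mem (hU (Submodule.mem_map_of_mem hqS))
          (Submodule.smul_mem _ _ hqS)))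
    · refine sup_le le_sup_left ?_
      rintro _ ⟨z, hz, rfl⟩
      rw [LinearMap.sub_apply]
      refine sub_mem (Submodule.mem_sup_left (hU (Submodule.mem_map_of_mem hz))) ?_
      rw [SetLike.mem_coe, hq] at hz
      obtain ⟨y, hy, c, rfl⟩ := Submodule.exists_of_mem_sup_span_singleton hz
      rw [map_add, map_smul, hfq, hf y hy]
      refine add_mem (Submodule.mem_sup_left (Submodule.mem_sup_left (h.mapsTo y hy)))
        (Submodule.smul_mem _ _ (sub_mem (Submodule.mem_sup_left (Submodule.smul_mem _ _ hqS))
          (Submodule.mem_sup_right (Submodule.mem_span_singleton_self x))))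
  · obtain ⟨y, hy, c, rfl⟩ := Submodule.exists_of_mem_sup_span_singleton hz
    rw [hq] at hy
    obtain ⟨t, ht, d, rfl⟩ := Submodule.exists_of_mem_sup_span_singleton hy
    simp only [map_add, map_smul, h4, smul_zero, add_zero, hfq, hf t ht]
    refine add_mem (Submodule.mem_sup_left (Submodule.mem_sup_left (h.mapsTo t ht)))
        (Submodule.smul_mem _ _ (sub_mem (Submodule.mem_sup_left (Submodule.smul_mem _ _ hqS))
          (Submodule.mem_sup_right (Submodule.mem_span_singleton_self x))))
  · obtain ⟨y, hy, c, rfl⟩ := Submodule.exists_of_mem_sup_span_singleton hz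
    rw [hq] at hy
    obtain ⟨t, ht, d, rfl⟩ := Submodule.exists_of_mem_sup_span_singleton hy
    simp only [map_add, map_smul, map_sub, h4, smul_zero, add_zero, sub_zero, hfq, hf t ht,
      hf _ (h.mapsTo t ht), h.quad t ht, smul_add]
    rw [smul_comm a d]
  · exact hx (hinv (Submodule.mem_map_of_mem
      (Submodule.mem_sup_right (Submodule.mem_span_singleton_self x))))

theorem of_not_mem_span {x : M} (hx : u x ∉ Submodule.span F {x}) :
    IsStage u a x 0 (Submodule.span F {x}) where
  chain := .base
  mapsTo z hz := by simp
  quad z hz := by simp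
  not_inv hinv := hx (hinv (Submodule.mem_map_of_mem (Submodule.mem_span_singleton_self x)))

/-- An eigenvector `e` cannot start a stage alone; the connecting trick `f e = a e - x`, `f x = 0`
adjoins `x` at once. -/
theorem of_mem_span {e x : M} (he0 : e ≠ 0) (he : u e ∈ Submodule.span F {e})
    (hx : u x ∉ Submodule.span F {e} ⊔ Submodule.span F {x}) :
    ∃ f, IsStage u a e f (Submodule.span F {e} ⊔ Submodule.span F {x}) := by
  have hxe : x ∉ Submodule.span F {e} := by
    intro hxe
    obtain ⟨c, rfl⟩ := Submodule.mem_span_singleton.1 hxe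
    rw [map_smul] at hx
    exact hx (Submodule.mem_sup_left (Submodule.smul_mem _ _ he))
  obtain ⟨f₁, -, h2⟩ := exists_linearMap_eqOn_of_notMem (0 : Module.End F M)
    (W := ⊥) (x := e) (by simpa using he0) (a • e - x)
  obtain ⟨f, h3, h4⟩ := exists_linearMap_eqOn_of_notMem f₁ hxe 0
  have hee := Submodule.mem_span_singleton_self (R := F) e
  have hxx := Submodule.mem_span_singleton_self (R := F) x
  have hfe : f e = a • e - x := (h3 e hee).trans h2
  obtain ⟨l, hl⟩ := Submodule.mem_span_singleton.1 he
  refine ⟨f, ?_, fun z hz => ?_, fun z hz => ?_, fun hinv =>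
    hx (hinv (Submodule.mem_map_of_mem (Submodule.mem_sup_right hxx)))⟩
  · have h5 := (KrylovChain.base (w := u - f) (v := e)).step
    convert h5 using 1
    rw [Submodule.map_span, Set.image_singleton]
    have h6 : (u - f) e = (l - a) • e + x := by
      rw [LinearMap.sub_apply, hfe, ← hl, sub_smul]; abel
    rw [h6]
    apply le_antisymm
    · refine sup_le le_sup_left ((Submodule.span_singleton_le_iff_mem _ _).2 ?_)
      have : ((l - a) • e + x) - (l - a) • e = x := by abel
      have h7 : ((l - a) • e + x) - (l - a) • e ∈
          Submodule.span F {e} ⊔ Submodule.span F {(l - a) • e + x} :=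
        sub_mem (Submodule.mem_sup_right (Submodule.mem_span_singleton_self _))
          (Submodule.mem_sup_left (Submodule.smul_mem _ _ hee))
      rwa [this] at h7
    · refine sup_le le_sup_left ((Submodule.span_singleton_le_iff_mem _ _).2 ?_)
      exact add_mem (Submodule.mem_sup_left (Submodule.smul_mem _ _ hee))
        (Submodule.mem_sup_right hxx)
  · obtain ⟨y, hy, c, rfl⟩ := Submodule.exists_of_mem_sup_span_singleton hz
    obtain ⟨d, rfl⟩ := Submodule.mem_span_singleton.1 hy
    simp only [map_add, map_smul, h4, smul_zero, add_zero, hfe]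
    exact Submodule.smul_mem _ _ (sub_mem (Submodule.mem_sup_left (Submodule.smul_mem _ _ hee))
      (Submodule.mem_sup_right hxx))
  · obtain ⟨y, hy, c, rfl⟩ := Submodule.exists_of_mem_sup_span_singleton hz
    obtain ⟨d, rfl⟩ := Submodule.mem_span_singleton.1 hy
    simp only [map_add, map_smul, map_sub, h4, smul_zero, add_zero, sub_zero, hfe]
    rw [smul_comm a d]

end IsStage

end Krylov

/-! ### Inserting a prescribed vector, together with its finite orbit, into a stage. -/

section Insertion

variable {F M : Type*} [Field F] [AddCommGroup M] [Module F M]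

/-- The span of `e, u e, ..., u ^ (n - 1) e`. -/
def orbitSpan (u : Module.End F M) (e : M) : ℕ → Submodule F M
  | 0 => ⊥
  | n + 1 => orbitSpan u e n ⊔ Submodule.span F {(u ^ n) e}

theorem orbitSpan_mono (u : Module.End F M) (e : M) : Monotone (orbitSpan u e) :=
  monotone_nat_of_le_succ fun _ => le_sup_left

theorem pow_apply_mem_orbitSpan (u : Module.End F M) (e : M) {i n : ℕ} (h : i < n) :
    (u ^ i) e ∈ orbitSpan u e n :=
  orbitSpan_mono u e (Nat.succ_le_of_lt h)
    (Submodule.mem_sup_right (Submodule.mem_span_singleton_self _))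

theorem map_orbitSpan_le (u : Module.End F M) (e : M) (n : ℕ) :
    (orbitSpan u e n).map u ≤ orbitSpan u e (n + 1) := by
  induction n with
  | zero => simp [orbitSpan]
  | succ n ih =>
    rw [orbitSpan, Submodule.map_sup, Submodule.map_span, Set.image_singleton]
    refine sup_le (ih.trans le_sup_left) ?_
    rw [Submodule.span_singleton_le_iff_mem, ← Module.End.mul_apply, ← pow_succ']
    exact pow_apply_mem_orbitSpan u e (Nat.lt_succ_self _)

theorem disjoint_orbitSpan {u : Module.End F M} {e : M} {W : Submodule F M} {n : ℕ}
    (h : ∀ j < n, (u ^ j) e ∉ W ⊔ orbitSpan u e j) : Disjoint W (orbitSpan u e n) := by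
  induction n with
  | zero => exact disjoint_bot_right
  | succ n ih =>
    have ih := ih fun j hj => h j (hj.trans (Nat.lt_succ_self n))
    rw [Submodule.disjoint_def] at ih ⊢
    intro x hx hx'
    obtain ⟨y, hy, c, rfl⟩ := Submodule.exists_of_mem_sup_span_singleton hx'
    by_cases hc : c = 0
    · subst hc
      rw [zero_smul, add_zero] at hx ⊢
      exact ih y hx hy
    · refine absurd ?_ (h n (Nat.lt_succ_self n))
      have : (u ^ n) e = c⁻¹ • ((y + c • (u ^ n) e) - y) := by
        rw [add_sub_cancel_left, smul_smul, inv_mul_cancel₀ hc, one_smul]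
      rw [this]
      exact Submodule.smul_mem _ _ (sub_mem (Submodule.mem_sup_left hx)
        (Submodule.mem_sup_right hy))

namespace IsStage

variable {u : Module.End F M} {a : F} {v : M} {f : Module.End F M} {U : Submodule F M}

/-- A detour of the Krylov orbit: `q` is sent to `e - a q`, then `u - f` follows `u` from `e` to `u
^ r e`, and the last vector is sent to `z = u q - e` modulo the part already reached. Thus `u q = e
+ z` is recovered and the original orbit can continue. The two non-zero corrections, `a q + z` and
`a (u ^ r e) - z`, satisfy the quadratic relation because `f z = 0`. -/
theorem exists_insert (h : IsStage u a v f U) {W : Submodule F M} (hUW : U ≤ W)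
    (hW : W.map u ≤ W) {e : M} {r : ℕ}
    (hind : ∀ j < r + 1, (u ^ j) e ∉ W ⊔ orbitSpan u e j)
    (hrel : (u ^ (r + 1)) e ∈ (U ⊔ U.map u) ⊔ orbitSpan u e (r + 1))
    (hS : ¬ ((U ⊔ U.map u) ⊔ (U ⊔ U.map u).map u).map u ≤
      (U ⊔ U.map u) ⊔ (U ⊔ U.map u).map u) :
    ∃ f' U', (∀ z ∈ U, f' z = f z) ∧ U ⊔ U.map u ≤ U' ∧ e ∈ U' ∧ IsStage u a v f' U' := by
  obtain ⟨q, hqU, hq⟩ := h.exists_next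
  set S := U ⊔ U.map u with hSdef
  set E := orbitSpan u e
  have hSW : S ≤ W := sup_le hUW ((Submodule.map_mono hUW).trans hW)
  have hqS : q ∈ S := hq ▸ Submodule.mem_sup_right (Submodule.mem_span_singleton_self q)
  have hUS : U ≤ S := le_sup_left
  have huU : ∀ y ∈ U, u y ∈ S := fun y hy => Submodule.mem_sup_right (Submodule.mem_map_of_mem hy)
  have hWE : Disjoint W (E (r + 1)) := disjoint_orbitSpan hind
  have hWE' := Submodule.disjoint_def.1 hWE
  have heE : ∀ j, e ∈ E (j + 1) := fun j => by
    have := pow_apply_mem_orbitSpan u e (Nat.succ_pos j)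
    simpa using this
  have hES : E r ≤ E (r + 1) := orbitSpan_mono u e (Nat.le_succ r)
  have huq : u q ∉ S := by
    intro huq
    have h1 : S.map u ≤ S := by
      rintro _ ⟨y, hy, rfl⟩
      rw [SetLike.mem_coe, hq] at hy
      obtain ⟨p, hp, c, rfl⟩ := Submodule.exists_of_mem_sup_span_singleton hy
      rw [map_add, map_smul]
      exact add_mem (huU p hp) (Submodule.smul_mem _ _ huq)
    rw [sup_eq_left.2 h1] at hS
    exact hS h1
  set z := u q - e with hz
  -- Since `u q` lies in `W` and `W` meets the orbit of `e` trivially, `z` in this sum would force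
  -- `u q ∈ S`. Hence `f z` is still free and can be set to `0`.
  have hzS : z ∉ S ⊔ E (r + 1) := by
    intro hzS
    have h1 : u q ∈ S ⊔ E (r + 1) := by
      have : u q = z + e := by simp [hz]
      rw [this]
      exact add_mem hzS (Submodule.mem_sup_right (heE r))
    obtain ⟨s, hs, t, ht, hst⟩ := Submodule.mem_sup.1 h1
    have h2 : t ∈ W := by
      have : t = u q - s := by rw [← hst]; abel
      rw [this]
      exact sub_mem (hW (Submodule.mem_map_of_mem (hSW hqS))) (hSW hs)
    rw [hWE' t h2 ht, add_zero] at hst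
    exact huq (hst ▸ hs)
  have her : (u ^ r) e ∉ E r := fun her =>
    hind r (Nat.lt_succ_self r) (Submodule.mem_sup_right her)
  obtain ⟨g, hg0, hg1⟩ := exists_linearMap_eqOn_of_notMem (0 : Module.End F M) her
    (a • (u ^ r) e - z)
  obtain ⟨f₁, hf₁, hf₁q⟩ := exists_linearMap_eqOn_of_notMem f hqU (a • q + z)
  obtain ⟨f₂, hf₂, hf₂E⟩ := exists_linearMap_eqOn_of_disjoint f₁ g (hWE.mono_left hSW)
  obtain ⟨f', hf', hf'z⟩ := exists_linearMap_eqOn_of_notMem f₂ hzS 0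
  have hfU : ∀ y ∈ U, f' y = f y := fun y hy => by
    rw [hf' y (Submodule.mem_sup_left (hUS hy)), hf₂ y (hUS hy), hf₁ y hy]
  have hfq : f' q = a • q + z := by
    rw [hf' q (Submodule.mem_sup_left hqS), hf₂ q hqS, hf₁q]
  have hfE : ∀ y ∈ E r, f' y = 0 := fun y hy => by
    rw [hf' y (Submodule.mem_sup_right (hES hy)), hf₂E y (hES hy), hg0 y hy]; rfl
  have herE : (u ^ r) e ∈ E (r + 1) := pow_apply_mem_orbitSpan u e (Nat.lt_succ_self r)
  have hfe : f' ((u ^ r) e) = a • (u ^ r) e - z := by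
    rw [hf' _ (Submodule.mem_sup_right herE), hf₂E _ herE, hg1]
  have hwU : ∀ y ∈ U, (u - f') y ∈ S := fun y hy => by
    rw [LinearMap.sub_apply, hfU y hy]
    exact sub_mem (huU y hy) (hUS (h.mapsTo y hy))
  have hwq : (u - f') q = e - a • q := by
    rw [LinearMap.sub_apply, hfq, hz]; abel
  have hwS : ∀ j, ∀ y ∈ S, (u - f') y ∈ S ⊔ E (j + 1) := by
    intro j y hy
    rw [hq] at hy
    obtain ⟨p, hp, c, rfl⟩ := Submodule.exists_of_mem_sup_span_singleton hy
    rw [map_add, map_smul, hwq]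
    exact add_mem (Submodule.mem_sup_left (hwU p hp)) (Submodule.smul_mem _ _
      (sub_mem (Submodule.mem_sup_right (heE j))
        (Submodule.mem_sup_left (Submodule.smul_mem _ _ hqS))))
  have hwE : ∀ j ≤ r, ∀ y ∈ E j, (u - f') y ∈ E (j + 1) := by
    intro j hj y hy
    rw [LinearMap.sub_apply, hfE y (orbitSpan_mono u e hj hy), sub_zero]
    exact map_orbitSpan_le u e j (Submodule.mem_map_of_mem hy)
  have hchain : ∀ j ≤ r + 1, KrylovChain (u - f') v (S ⊔ E j) := by
    intro j
    induction j with
    | zero =>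
      intro _
      have : S ⊔ E 0 = S := sup_bot_eq S
      rw [this]
      exact h.chain_sup hfU
    | succ j ih =>
      intro hj
      have hj' : j ≤ r := Nat.le_of_succ_le_succ hj
      convert (ih (hj'.trans (Nat.le_succ r))).step using 1
      apply le_antisymm
      · refine sup_le (le_sup_left.trans le_sup_left) (sup_le (le_sup_right.trans le_sup_left) ?_)
        rw [Submodule.span_singleton_le_iff_mem]
        cases j with
        | zero =>
          have : (u ^ 0) e = (u - f') q + a • q := by rw [hwq]; simp
          rw [this]
          exact add_mem (Submodule.mem_sup_right (Submodule.mem_map_of_mem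
            (Submodule.mem_sup_left hqS))) (Submodule.mem_sup_left (Submodule.mem_sup_left
              (Submodule.smul_mem _ _ hqS)))
        | succ j =>
          have h1 : (u ^ j) e ∈ E (j + 1) := pow_apply_mem_orbitSpan u e (Nat.lt_succ_self j)
          have : (u ^ (j + 1)) e = (u - f') ((u ^ j) e) := by
            rw [LinearMap.sub_apply, hfE _ (orbitSpan_mono u e hj' h1), sub_zero, pow_succ']
            rfl
          rw [this]
          exact Submodule.mem_sup_right (Submodule.mem_map_of_mem (Submodule.mem_sup_right h1))
      · refine sup_le (sup_le_sup_left (orbitSpan_mono u e (Nat.le_succ j)) S) ?_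
        rintro _ ⟨y, hy, rfl⟩
        obtain ⟨s, hs, t, ht, rfl⟩ := Submodule.mem_sup.1 hy
        rw [map_add]
        exact add_mem (hwS j s hs) (Submodule.mem_sup_right (hwE j hj' t ht))
  have hzz := Submodule.mem_span_singleton_self (R := F) z
  have hform : ∀ x ∈ (S ⊔ E (r + 1)) ⊔ Submodule.span F {z}, ∃ y ∈ U, ∃ c d : F,
      f' x = f y + c • (a • q + z) + d • (a • (u ^ r) e - z) := by
    intro x hx
    obtain ⟨x', hx', k, rfl⟩ := Submodule.exists_of_mem_sup_span_singleton hx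
    obtain ⟨s, hs, t, ht, rfl⟩ := Submodule.mem_sup.1 hx'
    rw [hq] at hs
    obtain ⟨y, hy, c, rfl⟩ := Submodule.exists_of_mem_sup_span_singleton hs
    obtain ⟨t', ht', d, rfl⟩ := Submodule.exists_of_mem_sup_span_singleton ht
    refine ⟨y, hy, c, d, ?_⟩
    simp only [map_add, map_smul, hf'z, smul_zero, add_zero, hfU y hy, hfq, hfE t' ht', zero_add,
      hfe]
  refine ⟨f', (S ⊔ E (r + 1)) ⊔ Submodule.span F {z}, hfU, le_sup_left.trans le_sup_left,
    Submodule.mem_sup_left (Submodule.mem_sup_right (heE r)), ?_, fun x hx => ?_,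
    fun x hx => ?_, fun hinv => hS ?_⟩
  · convert (hchain (r + 1) le_rfl).step using 1
    apply le_antisymm
    · refine sup_le le_sup_left ((Submodule.span_singleton_le_iff_mem _ _).2 ?_)
      have : z = (u - f') ((u ^ r) e) - ((u ^ (r + 1)) e - a • (u ^ r) e) := by
        rw [LinearMap.sub_apply, hfe, pow_succ', Module.End.mul_apply]; abel
      rw [this]
      exact sub_mem (Submodule.mem_sup_right (Submodule.mem_map_of_mem
        (Submodule.mem_sup_right herE))) (Submodule.mem_sup_left (sub_mem hrel
          (Submodule.mem_sup_right (Submodule.smul_mem _ _ herE))))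
    · refine sup_le le_sup_left ?_
      rintro _ ⟨x, hx, rfl⟩
      obtain ⟨s, hs, t, ht, rfl⟩ := Submodule.mem_sup.1 hx
      obtain ⟨t', ht', d, rfl⟩ := Submodule.exists_of_mem_sup_span_singleton ht
      have h1 : (u - f') ((u ^ r) e) = (u ^ (r + 1)) e - a • (u ^ r) e + z := by
        rw [LinearMap.sub_apply, hfe, pow_succ', Module.End.mul_apply]; abel
      rw [map_add, map_add, map_smul, h1]
      refine add_mem (Submodule.mem_sup_left (hwS r s hs)) (add_mem (Submodule.mem_sup_left
        (Submodule.mem_sup_right (hwE r le_rfl t' ht'))) (Submodule.smul_mem _ _ (add_mem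
          (Submodule.mem_sup_left (sub_mem hrel
            (Submodule.mem_sup_right (Submodule.smul_mem _ _ herE))))
          (Submodule.mem_sup_right hzz))))
  · obtain ⟨y, hy, c, d, e1⟩ := hform x hx
    rw [e1]
    refine add_mem (add_mem (Submodule.mem_sup_left (Submodule.mem_sup_left
      (hUS (h.mapsTo y hy)))) (Submodule.smul_mem _ _ (add_mem (Submodule.mem_sup_left
        (Submodule.mem_sup_left (Submodule.smul_mem _ _ hqS))) (Submodule.mem_sup_right hzz))))
      (Submodule.smul_mem _ _ (sub_mem (Submodule.mem_sup_left (Submodule.mem_sup_right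
        (Submodule.smul_mem _ _ herE))) (Submodule.mem_sup_right hzz)))
  · obtain ⟨y, hy, c, d, e1⟩ := hform x hx
    rw [e1]
    simp only [map_add, map_sub, map_smul, hfU _ (h.mapsTo y hy), h.quad y hy, hfq, hfe, hf'z,
      add_zero, sub_zero, smul_zero, smul_add, smul_sub]
    rw [smul_comm a c, smul_comm a c, smul_comm a d, smul_comm a d]
  -- If the new space were invariant it would contain `u (u q)`, which lies in `W`. The
  -- `E`-component then vanishes, leaving `u (u q) ∈ S + F u q`, so `S + u S` would be invariant,
  -- against `hS`.
  · have h0 : u q ∈ (S ⊔ E (r + 1)) ⊔ Submodule.span F {z} := by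
      have : u q = e + z := by simp [hz]
      rw [this]
      exact add_mem (Submodule.mem_sup_left (Submodule.mem_sup_right (heE r)))
        (Submodule.mem_sup_right hzz)
    have huqS : u q ∈ S ⊔ S.map u := Submodule.mem_sup_right (Submodule.mem_map_of_mem hqS)
    have h1 : u (u q) ∈ S ⊔ S.map u := by
      obtain ⟨x, hx, k, hk⟩ := Submodule.exists_of_mem_sup_span_singleton
        (hinv (Submodule.mem_map_of_mem h0))
      obtain ⟨s, hs, t, ht, hst⟩ := Submodule.mem_sup.1 hx
      have h2 : t - k • e = u (u q) - s - k • u q := by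
        rw [← hk, ← hst, hz, smul_sub]; abel
      have h3 : u q ∈ W := hW (Submodule.mem_map_of_mem (hSW hqS))
      have h6 : t - k • e ∈ W := by
        rw [h2]
        exact sub_mem (sub_mem (hW (Submodule.mem_map_of_mem h3)) (hSW hs))
          (Submodule.smul_mem _ _ h3)
      have h4 := hWE' (t - k • e) h6 (sub_mem ht (Submodule.smul_mem _ _ (heE r)))
      have h5 : u (u q) = s + k • u q := by
        rw [h2, sub_sub, sub_eq_zero] at h4
        exact h4
      rw [h5]
      exact add_mem (Submodule.mem_sup_left hs) (Submodule.smul_mem _ _ huqS)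
    have h2 : ∀ x ∈ S, u (u x) ∈ S ⊔ S.map u := by
      intro x hx
      rw [hq] at hx
      obtain ⟨y, hy, c, rfl⟩ := Submodule.exists_of_mem_sup_span_singleton hx
      rw [map_add, map_add, map_smul, map_smul]
      exact add_mem (Submodule.mem_sup_right (Submodule.mem_map_of_mem (huU y hy)))
        (Submodule.smul_mem _ _ h1)
    rw [Submodule.map_sup]
    refine sup_le le_sup_right ?_
    rintro _ ⟨_, ⟨x, hx, rfl⟩, rfl⟩
    exact h2 x hx

end IsStage

end Insertion

/-! ### Limits of stages: infinite-dimensional cyclic parts. -/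

section Limit

variable {F M : Type*} [Field F] [AddCommGroup M] [Module F M]

/-- Some `f` with `f ^ 2 = a f` on `P` makes `P` a cyclic, infinite-dimensional module under
`u - f`. -/
def CyclicPart (u : Module.End F M) (a : F) (P : Submodule F M) : Prop :=
  ∃ (f : Module.End F M) (v : M), v ∈ P ∧ (∀ z ∈ P, f z ∈ P) ∧ (∀ z ∈ P, f (f z) = a • f z) ∧
    (∀ z ∈ P, ∃ p : F[X], z = aeval (u - f) p v) ∧ ¬ P.FG

theorem Submodule.FG.exists_le_of_le_iSup {G : Submodule F M} (hG : G.FG)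
    {U : ℕ → Submodule F M} (hU : Monotone U) (h : G ≤ ⨆ n, U n) : ∃ n, G ≤ U n := by
  classical
  obtain ⟨S, rfl⟩ := hG
  have hmem : ∀ z : M, ∃ n, z ∈ S → z ∈ U n := by
    intro z
    by_cases hz : z ∈ S
    · obtain ⟨n, hn⟩ := (Submodule.mem_iSup_of_directed U hU.directed_le).1
        (h (Submodule.subset_span hz))
      exact ⟨n, fun _ => hn⟩
    · exact ⟨0, fun h => absurd h hz⟩
  choose N hN using hmem
  exact ⟨S.sup N, Submodule.span_le.2 fun z hz => hU (Finset.le_sup hz) (hN z hz)⟩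

theorem exists_linearMap_eqOn_of_monotone {U : ℕ → Submodule F M} (hU : Monotone U)
    (f : ℕ → Module.End F M) (hf : ∀ n, ∀ z ∈ U n, f (n + 1) z = f n z) :
    ∃ g : Module.End F M, ∀ n, ∀ z ∈ U n, g z = f n z := by
  classical
  have hf' : ∀ m n, m ≤ n → ∀ z ∈ U m, f n z = f m z := by
    intro m n hmn z hz
    induction n, hmn using Nat.le_induction with
    | base => rfl
    | succ n hmn ih => rw [hf n z (hU hmn hz), ih]
  have hmem : ∀ z : (⨆ n, U n : Submodule F M), ∃ n, (z : M) ∈ U n := fun z =>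
    (Submodule.mem_iSup_of_directed U hU.directed_le).1 z.2
  choose N hN using hmem
  have key : ∀ (z : (⨆ n, U n : Submodule F M)) n, (z : M) ∈ U n → f (N z) z = f n z := by
    intro z n hz
    rcases le_total (N z) n with h | h
    · exact (hf' _ _ h _ (hN z)).symm
    · exact hf' _ _ h _ hz
  let g₀ : (⨆ n, U n : Submodule F M) →ₗ[F] M :=
    { toFun := fun z => f (N z) z
      map_add' := by
        intro x y
        have hx := hU (le_max_left (N x) (N y)) (hN x)
        have hy := hU (le_max_right (N x) (N y)) (hN y)
        rw [key x _ hx, key y _ hy, key (x + y) _ (add_mem hx hy)]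
        simp
      map_smul' := by
        intro c x
        rw [key (c • x) _ (Submodule.smul_mem _ c (hN x))]
        simp }
  obtain ⟨g, hg⟩ := g₀.exists_extend
  refine ⟨g, fun n z hz => ?_⟩
  have hz' : z ∈ ⨆ n, U n := Submodule.mem_iSup_of_mem n hz
  have h1 : g z = g₀ ⟨z, hz'⟩ := by rw [← hg]; rfl
  rw [h1]
  exact key ⟨z, hz'⟩ n hz

/-- Countable iteration of a step: `t` lists the vectors to be absorbed, and `R` is a property that
all the stages keep. -/
theorem IsStage.exists_cyclicPart {u : Module.End F M} {a : F} {v : M} (R : Submodule F M → Prop)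
    (t : ℕ → M) {f : Module.End F M} {U : Submodule F M} (h : IsStage u a v f U) (hR : R U)
    (step : ∀ k f U, IsStage u a v f U → R U → ∃ f' U', (∀ z ∈ U, f' z = f z) ∧
      U ⊔ U.map u ≤ U' ∧ t k ∈ U' ∧ IsStage u a v f' U' ∧ R U') :
    ∃ P, CyclicPart u a P ∧ P.map u ≤ P ∧ U ≤ P ∧ (∀ k, t k ∈ P) ∧
      ∀ z ∈ P, ∃ U', R U' ∧ z ∈ U' := by
  let T := {s : Module.End F M × Submodule F M // IsStage u a v s.1 s.2 ∧ R s.2}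
  have step' : ∀ (k : ℕ) (s : T), ∃ s' : T, (∀ z ∈ s.1.2, s'.1.1 z = s.1.1 z) ∧
      s.1.2 ⊔ s.1.2.map u ≤ s'.1.2 ∧ t k ∈ s'.1.2 := by
    rintro k ⟨⟨f, U⟩, h, hR⟩
    obtain ⟨f', U', h1, h2, h3, h4, h5⟩ := step k f U h hR
    exact ⟨⟨⟨f', U'⟩, h4, h5⟩, h1, h2, h3⟩
  choose nxt hn1 hn2 hn3 using step'
  let s : ℕ → T := fun n => Nat.rec ⟨⟨f, U⟩, h, hR⟩ nxt n
  have hs : ∀ n, s (n + 1) = nxt n (s n) := fun n => rfl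
  have hmono : Monotone fun n => (s n).1.2 := monotone_nat_of_le_succ fun n => by
    rw [hs]; exact le_sup_left.trans (hn2 n (s n))
  obtain ⟨g, hg⟩ := exists_linearMap_eqOn_of_monotone hmono (fun n => (s n).1.1) fun n z hz => by
    rw [hs]; exact hn1 n (s n) z hz
  have hmem : ∀ z, z ∈ (⨆ n, (s n).1.2) ↔ ∃ n, z ∈ (s n).1.2 := fun z =>
    Submodule.mem_iSup_of_directed _ hmono.directed_le
  have huP : (⨆ n, (s n).1.2).map u ≤ ⨆ n, (s n).1.2 := by
    rintro _ ⟨z, hz, rfl⟩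
    obtain ⟨n, hn⟩ := (hmem z).1 hz
    refine (hmem _).2 ⟨n + 1, ?_⟩
    rw [hs]
    exact hn2 n (s n) (Submodule.mem_sup_right (Submodule.mem_map_of_mem hn))
  refine ⟨⨆ n, (s n).1.2, ⟨g, v, ?_, fun z hz => ?_, fun z hz => ?_, fun z hz => ?_, fun hfg => ?_⟩,
    huP, ?_, fun k => ?_, fun z hz => ?_⟩
  · exact (hmem v).2 ⟨0, (s 0).2.1.chain.mem⟩
  · obtain ⟨n, hn⟩ := (hmem z).1 hz
    rw [hg n z hn]
    exact (hmem _).2 ⟨n, (s n).2.1.mapsTo z hn⟩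
  · obtain ⟨n, hn⟩ := (hmem z).1 hz
    rw [hg n z hn, hg n _ ((s n).2.1.mapsTo z hn), (s n).2.1.quad z hn]
  · obtain ⟨n, hn⟩ := (hmem z).1 hz
    exact ((s n).2.1.chain.congr (w' := u - g) fun z hz => by simp [hg n z hz]).exists_aeval z hn
  -- A finite-dimensional union would be reached at some stage, but the union is invariant and no
  -- stage is.
  · obtain ⟨n, hn⟩ := hfg.exists_le_of_le_iSup hmono le_rfl
    have heq : (s n).1.2 = ⨆ n, (s n).1.2 := le_antisymm (le_iSup (fun n => (s n).1.2) n) hn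
    exact (s n).2.1.not_inv (heq ▸ huP)
  · exact le_iSup (fun n => (s n).1.2) 0
  · refine (hmem _).2 ⟨k + 1, ?_⟩
    rw [hs]
    exact hn3 k (s k)
  · obtain ⟨n, hn⟩ := (hmem z).1 hz
    exact ⟨_, (s n).2.2, hn⟩

/-- If `u` is non-scalar on `N` modulo every finite-dimensional subspace, every vector of `N` lies
in an invariant subspace of `N` that can be made cyclic. -/
theorem exists_cyclicPart_of_forall_fg {u : Module.End F M} (a : F) {N : Submodule F M}
    (hN : N.map u ≤ N)
    (h : ∀ Y : Submodule F M, Y.FG → ∃ x ∈ N, u x ∉ Y ⊔ Submodule.span F {x}) {e : M}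
    (he : e ∈ N) : ∃ P, CyclicPart u a P ∧ P.map u ≤ P ∧ e ∈ P ∧ P ≤ N := by
  have step : ∀ v f U, IsStage u a v f U → U ≤ N → ∃ f' U', (∀ z ∈ U, f' z = f z) ∧
      U ⊔ U.map u ≤ U' ∧ (0 : M) ∈ U' ∧ IsStage u a v f' U' ∧ U' ≤ N := by
    intro v f U hs hU
    have hSN : U ⊔ U.map u ≤ N := sup_le hU ((Submodule.map_mono hU).trans hN)
    by_cases hinv : (U ⊔ U.map u).map u ≤ U ⊔ U.map u
    · obtain ⟨x, hxN, hx⟩ := h (U ⊔ U.map u) (hs.chain.fg.sup (hs.chain.fg.map u))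
      obtain ⟨f', h1, h2⟩ := hs.exists_connect hinv hx
      exact ⟨f', _, h1, le_sup_left, zero_mem _, h2,
        sup_le hSN ((Submodule.span_singleton_le_iff_mem _ _).2 hxN)⟩
    · obtain ⟨f', h1, h2⟩ := hs.exists_advance hinv
      exact ⟨f', _, h1, le_rfl, zero_mem _, h2, hSN⟩
  have fin : ∀ v f U, IsStage u a v f U → U ≤ N → e ∈ U →
      ∃ P, CyclicPart u a P ∧ P.map u ≤ P ∧ e ∈ P ∧ P ≤ N := by
    intro v f U hs hU heU
    obtain ⟨P, h1, h2, h3, -, h4⟩ := hs.exists_cyclicPart (fun U => U ≤ N) (fun _ => 0) hU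
      fun _ => step v
    exact ⟨P, h1, h2, h3 heU, fun z hz => by
      obtain ⟨U', h5, h6⟩ := h4 z hz
      exact h5 h6⟩
  by_cases he1 : u e ∈ Submodule.span F {e}
  · obtain ⟨x, hxN, hx⟩ := h (Submodule.span F {e}) (Submodule.fg_span_singleton e)
    by_cases he0 : e = 0
    · subst he0
      rw [Submodule.span_zero_singleton, bot_sup_eq] at hx
      exact fin x 0 _ (IsStage.of_not_mem_span hx)
        ((Submodule.span_singleton_le_iff_mem _ _).2 hxN) (zero_mem _)
    · obtain ⟨f, hf⟩ := IsStage.of_mem_span (a := a) he0 he1 hx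
      exact fin e f _ hf (sup_le ((Submodule.span_singleton_le_iff_mem _ _).2 he)
        ((Submodule.span_singleton_le_iff_mem _ _).2 hxN))
        (Submodule.mem_sup_left (Submodule.mem_span_singleton_self e))
  · exact fin e 0 _ (IsStage.of_not_mem_span he1)
      ((Submodule.span_singleton_le_iff_mem _ _).2 he) (Submodule.mem_span_singleton_self e)

end Limit

/-! ### Gluing the cyclic sections of a well-ordered chain. -/

section Gluing

variable {F V : Type*} [Field F] [AddCommGroup V] [Module F V]

/-- In a vanishing finite sum, the term of largest index lies in the span of the earlier subspaces,
so it is zero. -/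
theorem Submodule.iSupIndep_of_disjoint_lt {ι : Type*} [LinearOrder ι] {K : ι → Submodule F V}
    (h : ∀ i, Disjoint (K i) (⨆ j < i, K j)) : iSupIndep K := by
  classical
  refine iSupIndep_of_dfinsupp_lsum_injective K ?_
  rw [← LinearMap.ker_eq_bot, Submodule.eq_bot_iff]
  intro m hm
  by_contra hne
  have hs : m.support.Nonempty := by
    rw [Finset.nonempty_iff_ne_empty]
    exact fun h0 => hne (DFinsupp.support_eq_empty.1 h0)
  set i := m.support.max' hs
  have hi : i ∈ m.support := Finset.max'_mem _ _
  have hsum : (m i : V) + ∑ j ∈ m.support.erase i, (m j : V) = 0 := by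
    rw [Finset.add_sum_erase _ (fun j => (m j : V)) hi]
    simpa [DFinsupp.lsum_apply_apply, DFinsupp.sumAddHom_apply, DFinsupp.sum] using hm
  have h1 : ∑ j ∈ m.support.erase i, (m j : V) ∈ ⨆ j < i, K j := by
    refine Submodule.sum_mem _ fun j hj => ?_
    have hlt : j < i := lt_of_le_of_ne (Finset.le_max' _ _ (Finset.mem_of_mem_erase hj))
      (Finset.ne_of_mem_erase hj)
    exact Submodule.mem_iSup_of_mem j (Submodule.mem_iSup_of_mem hlt (m j).2)
  have h2 : (m i : V) = 0 := by
    refine Submodule.disjoint_def.1 (h i) _ (m i).2 ?_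
    rw [eq_neg_of_add_eq_zero_left hsum]
    exact neg_mem h1
  exact DFinsupp.mem_support_iff.1 hi (Subtype.ext h2)

theorem DirectSum.IsInternal.exists_linearMap {ι : Type*} [DecidableEq ι] {K : ι → Submodule F V}
    (h : DirectSum.IsInternal K) (g : ι → V →ₗ[F] V) :
    ∃ f : V →ₗ[F] V, ∀ i, ∀ z ∈ K i, f z = g i z := by
  refine ⟨(DirectSum.toModule F ι V fun i => (g i).domRestrict (K i)).comp
    (LinearEquiv.ofBijective (DirectSum.coeLinearMap K) h).symm.toLinearMap, fun i z hz => ?_⟩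
  have h1 : (LinearEquiv.ofBijective (DirectSum.coeLinearMap K) h).symm z =
      DirectSum.lof F ι (fun i => K i) i ⟨z, hz⟩ := by
    rw [LinearEquiv.symm_apply_eq]
    exact (DirectSum.coeLinearMap_of K i ⟨z, hz⟩).symm
  rw [LinearMap.comp_apply, LinearEquiv.coe_coe, h1, DirectSum.toModule_lof]
  rfl

theorem iSup_lt_le_of_forall_le {ι : Type*} [LinearOrder ι] [WellFoundedLT ι]
    {U K : ι → Submodule F V} (h : ∀ i, U i ≤ (⨆ j < i, U j) ⊔ K i) (i : ι) :
    U i ≤ ⨆ j, ⨆ (_ : j ≤ i), K j := by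
  induction i using WellFoundedLT.induction with
  | ind i ih =>
    refine (h i).trans (sup_le (iSup₂_le fun j hj => (ih j hj).trans ?_) ?_)
    · exact iSup₂_le fun k hk => le_iSup₂_of_le k (hk.trans hj.le) le_rfl
    · exact le_iSup₂_of_le i le_rfl le_rfl

theorem isInternal_of_disjoint_of_le {ι : Type*} [LinearOrder ι] [WellFoundedLT ι]
    {U K : ι → Submodule F V} (hKU : ∀ i, K i ≤ U i)
    (hdisj : ∀ i, Disjoint (K i) (⨆ j < i, U j)) (hle : ∀ i, U i ≤ (⨆ j < i, U j) ⊔ K i)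
    (htop : ⨆ i, U i = ⊤) : DirectSum.IsInternal K := by
  refine DirectSum.isInternal_submodule_of_iSupIndep_of_iSup_eq_top
    (Submodule.iSupIndep_of_disjoint_lt fun i => (hdisj i).mono_right
      (iSup₂_mono fun j _ => hKU j)) (top_le_iff.1 ?_)
  rw [← htop]
  exact iSup_le fun i => (iSup_lt_le_of_forall_le hle i).trans
    (iSup₂_le fun j _ => le_iSup K j)

/-- If `p` killed `v`, division by `p` would exhibit `P` inside the image of the polynomials of
degree less than `deg p`. So an infinite-dimensional cyclic module is free over `F[X]`. -/
theorem aeval_apply_ne_zero_of_not_fg {w : Module.End F V} {v : V} {P : Submodule F V}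
    (hP : ∀ z ∈ P, ∃ p : F[X], z = aeval w p v) (hfg : ¬ P.FG) {p : F[X]} (hp : p ≠ 0) :
    aeval w p v ≠ 0 := by
  intro h0
  let T : F[X] →ₗ[F] V := (LinearMap.applyₗ v).comp (aeval w).toLinearMap
  have hT : ∀ q, T q = aeval w q v := fun q => rfl
  have hle : P ≤ (degreeLT F p.natDegree).map T := by
    intro z hz
    obtain ⟨q, rfl⟩ := hP z hz
    refine ⟨q % p, ?_, ?_⟩
    · rw [SetLike.mem_coe, mem_degreeLT, ← degree_eq_natDegree hp]
      exact EuclideanDomain.mod_lt q hp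
    · rw [hT]
      conv_rhs => rw [← EuclideanDomain.mod_add_div q p]
      rw [mul_comm]
      simp [h0]
  have hfin : (degreeLT F p.natDegree).FG := by
    have : Module.Finite F (degreeLT F p.natDegree) :=
      Module.Finite.equiv (degreeLTEquiv F p.natDegree).symm
    exact Module.Finite.iff_fg.1 this
  have h1 := hfin.map T
  have : Module.Finite F ((degreeLT F p.natDegree).map T) := Module.Finite.iff_fg.2 h1
  exact hfg (Module.Finite.iff_fg.1 (Submodule.finiteDimensional_of_le hle))

/-- `P` is an invariant subspace above the invariant subspace `A`, and the map induced by `u` on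
`P / A` can be made cyclic. -/
def CyclicSection (u : Module.End F V) (a : F) (A P : Submodule F V) : Prop :=
  ∃ hA : A ≤ A.comap u, A ≤ P ∧ P.map u ≤ P ∧ CyclicPart (A.mapQ A u hA) a (P.map A.mkQ)

/-- Free sections split: lifts of their generators form an `F[X]`-basis of `V` under `u - f`. Any
sequence of polynomials with one in each degree then gives an `F`-basis, which leaves `S` to be
chosen later. -/
theorem exists_basis_of_chain {ι : Type*} [LinearOrder ι] [WellFoundedLT ι]
    (u : Module.End F V) (a : F) (U : ι → Submodule F V)
    (hU : ∀ i, CyclicSection u a (⨆ j < i, U j) (U i)) (htop : ⨆ i, U i = ⊤)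
    (S : Polynomial.Sequence F) :
    ∃ (f : Module.End F V) (v : ι → V) (b : Module.Basis (Σ _ : ι, ℕ) F V),
      (∀ z, f (f z) = a • f z) ∧ ∀ i n, b ⟨i, n⟩ = aeval (u - f) (S n) (v i) := by
  classical
  choose hA hAU hinv g v' hv' hg hq hcyc hfg using hU
  set A : ι → Submodule F V := fun i => ⨆ j < i, U j with hAdef
  have hsec : ∀ i, ∃ σ : (V ⧸ A i) →ₗ[F] V, (A i).mkQ ∘ₗ σ = LinearMap.id := fun i =>
    LinearMap.exists_rightInverse_of_surjective _ (Submodule.range_mkQ _)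
  choose σ hσ using hsec
  have hσ' : ∀ i x, (A i).mkQ (σ i x) = x := fun i x => LinearMap.congr_fun (hσ i) x
  have hmk : ∀ i z, (A i).mkQ z = 0 ↔ z ∈ A i := fun i z => by simp
  have hσU : ∀ i, ∀ x ∈ (U i).map (A i).mkQ, σ i x ∈ U i := by
    rintro i _ ⟨z, hz, rfl⟩
    have h1 : σ i ((A i).mkQ z) - z ∈ A i := by
      rw [← hmk, map_sub, hσ', sub_self]
    have h2 := add_mem (hAU i h1) hz
    rwa [sub_add_cancel] at h2
  -- A linear complement of `A i` in `U i`, in general not `u`-invariant. Transporting each `g i` to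
  -- `K i` keeps the quadratic relation exact, not merely modulo `A i`.
  let K : ι → Submodule F V := fun i => ((U i).map (A i).mkQ).map (σ i)
  have hKU : ∀ i, K i ≤ U i := by
    rintro i _ ⟨x, hx, rfl⟩
    exact hσU i x hx
  have hKA : ∀ i, Disjoint (K i) (A i) := by
    intro i
    rw [Submodule.disjoint_def]
    rintro _ ⟨x, hx, rfl⟩ h1
    rw [← hmk, hσ'] at h1
    rw [h1, map_zero]
  have hUK : ∀ i, U i ≤ A i ⊔ K i := by
    intro i z hz
    have h1 : z - σ i ((A i).mkQ z) ∈ A i := by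
      rw [← hmk, map_sub, hσ', sub_self]
    have h2 : σ i ((A i).mkQ z) ∈ K i := Submodule.mem_map_of_mem (Submodule.mem_map_of_mem hz)
    have := add_mem (Submodule.mem_sup_left (T := K i) h1) (Submodule.mem_sup_right h2)
    rwa [sub_add_cancel] at this
  have hK := isInternal_of_disjoint_of_le hKU hKA hUK htop
  obtain ⟨f, hf⟩ := hK.exists_linearMap fun i => (σ i) ∘ₗ (g i) ∘ₗ (A i).mkQ
  have hf' : ∀ i, ∀ x ∈ (U i).map (A i).mkQ, f (σ i x) = σ i (g i x) := by
    intro i x hx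
    rw [hf i _ (Submodule.mem_map_of_mem hx)]
    simp only [LinearMap.comp_apply, hσ']
  have hfK : ∀ i, (K i).map f ≤ K i := by
    rintro i _ ⟨_, ⟨x, hx, rfl⟩, rfl⟩
    rw [hf' i x hx]
    exact Submodule.mem_map_of_mem (hg i x hx)
  have hquad : ∀ z, f (f z) = a • f z := by
    intro z
    have h1 : ⨆ i, K i ≤ LinearMap.ker (f ∘ₗ f - a • f) := by
      refine iSup_le fun i => ?_
      rintro _ ⟨x, hx, rfl⟩
      rw [LinearMap.mem_ker, LinearMap.sub_apply, LinearMap.comp_apply, LinearMap.smul_apply,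
        hf' i x hx, hf' i _ (hg i x hx), hq i x hx, map_smul, sub_self]
    rw [hK.submodule_iSup_eq_top] at h1
    have h2 := h1 (Submodule.mem_top (x := z))
    rwa [LinearMap.mem_ker, LinearMap.sub_apply, LinearMap.comp_apply, LinearMap.smul_apply,
      sub_eq_zero] at h2
  -- Needed for `u - f` to act on the sections; there it induces the given cyclic map.
  have hfU : ∀ i, (U i).map f ≤ U i := by
    intro i
    induction i using WellFoundedLT.induction with
    | ind i ih =>
      refine (Submodule.map_mono (hUK i)).trans ?_
      rw [Submodule.map_sup]
      refine sup_le ?_ ((hfK i).trans (hKU i))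
      rw [Submodule.map_iSup]
      refine iSup_le fun j => ?_
      rw [Submodule.map_iSup]
      exact iSup_le fun hj => (ih j hj).trans ((le_iSup₂_of_le j hj le_rfl).trans (hAU i))
  have hfA : ∀ i, (A i).map f ≤ A i := by
    intro i
    rw [hAdef]
    simp only [Submodule.map_iSup]
    exact iSup₂_mono fun j _ => hfU j
  have hπf : ∀ i, ∀ z ∈ U i, (A i).mkQ (f z) = g i ((A i).mkQ z) := by
    intro i z hz
    obtain ⟨y, hy, _, ⟨x, hx, rfl⟩, rfl⟩ := Submodule.mem_sup.1 (hUK i hz)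
    rw [map_add, map_add, map_add, (hmk i y).2 hy,
      (hmk i (f y)).2 (hfA i (Submodule.mem_map_of_mem hy)), zero_add, zero_add, hf' i x hx, hσ',
      hσ']
  have hwU : ∀ i, ∀ z ∈ U i, (u - f) z ∈ U i := fun i z hz =>
    sub_mem (hinv i (Submodule.mem_map_of_mem hz)) (hfU i (Submodule.mem_map_of_mem hz))
  have hlift : ∀ i, ∃ x ∈ U i, (A i).mkQ x = v' i := fun i => hv' i
  choose v hvU hv using hlift
  set w' : ∀ i, Module.End F (V ⧸ A i) := fun i => (A i).mapQ (A i) u (hA i) - g i with hw'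
  have hπw : ∀ i, ∀ z ∈ U i, (A i).mkQ ((u - f) z) = w' i ((A i).mkQ z) := by
    intro i z hz
    rw [LinearMap.sub_apply, map_sub, hπf i z hz]
    rfl
  have hpoly : ∀ i, ∀ p : F[X], ∀ z ∈ U i, aeval (u - f) p z ∈ U i ∧
      (A i).mkQ (aeval (u - f) p z) = aeval (w' i) p ((A i).mkQ z) := by
    intro i p
    induction p using Polynomial.induction_on' with
    | add p q hp hq =>
      intro z hz
      rw [map_add, map_add, LinearMap.add_apply, LinearMap.add_apply, map_add, (hp z hz).2,
        (hq z hz).2]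
      exact ⟨add_mem (hp z hz).1 (hq z hz).1, rfl⟩
    | monomial n c =>
      have hpow : ∀ z ∈ U i, ((u - f) ^ n) z ∈ U i ∧
          (A i).mkQ (((u - f) ^ n) z) = (w' i ^ n) ((A i).mkQ z) := by
        induction n with
        | zero => exact fun z hz => ⟨hz, rfl⟩
        | succ n ih =>
          intro z hz
          rw [pow_succ', pow_succ', Module.End.mul_apply, Module.End.mul_apply,
            hπw i _ (ih z hz).1, (ih z hz).2]
          exact ⟨hwU i _ (ih z hz).1, rfl⟩
      intro z hz
      rw [aeval_monomial, aeval_monomial, Module.End.mul_apply, Module.End.mul_apply,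
        Module.algebraMap_end_apply, Module.algebraMap_end_apply, map_smul, (hpow z hz).2]
      exact ⟨Submodule.smul_mem _ _ (hpow z hz).1, rfl⟩
  let T : ι → F[X] →ₗ[F] V := fun i => (LinearMap.applyₗ (v i)).comp (aeval (u - f)).toLinearMap
  have hT : ∀ i p, T i p = aeval (u - f) p (v i) := fun i p => rfl
  have hπT : ∀ i p, (A i).mkQ (T i p) = aeval (w' i) p (v' i) := by
    intro i p
    rw [hT, (hpoly i p (v i) (hvU i)).2, hv]
  have hne : ∀ i, ∀ p : F[X], p ≠ 0 → aeval (w' i) p (v' i) ≠ 0 := fun i p hp =>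
    aeval_apply_ne_zero_of_not_fg (hcyc i) (hfg i) hp
  have hTinj : ∀ i, Function.Injective (T i) := by
    intro i
    rw [← LinearMap.ker_eq_bot, Submodule.eq_bot_iff]
    intro p hp
    by_contra hp0
    refine hne i p hp0 ?_
    rw [← hπT, LinearMap.mem_ker.1 hp, map_zero]
  -- The orbits of the lifted generators are a second family of complements to the `A i`, this time
  -- stable under `u - f`.
  have hN : DirectSum.IsInternal fun i => LinearMap.range (T i) := by
    refine isInternal_of_disjoint_of_le (U := U) ?_ ?_ ?_ htop
    · rintro i _ ⟨p, rfl⟩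
      exact (hpoly i p (v i) (hvU i)).1
    · intro i
      rw [Submodule.disjoint_def]
      rintro _ ⟨p, rfl⟩ h1
      have h2 : (A i).mkQ (T i p) = 0 := (hmk i _).2 h1
      rw [hπT] at h2
      have : p = 0 := by
        by_contra hp
        exact hne i p hp h2
      rw [this, map_zero]
    · intro i z hz
      obtain ⟨p, hp⟩ := hcyc i _ (Submodule.mem_map_of_mem hz)
      have h1 : z - T i p ∈ A i := by
        rw [← hmk, map_sub, hπT, hp, sub_self]
      have := add_mem (Submodule.mem_sup_left (T := LinearMap.range (T i)) h1)
        (Submodule.mem_sup_right ⟨p, rfl⟩)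
      rwa [sub_add_cancel] at this
  have hS : ∀ n, IsUnit (S n).leadingCoeff := fun n =>
    (leadingCoeff_ne_zero.2 (S.ne_zero n)).isUnit
  refine ⟨f, v, hN.collectedBasis fun i =>
    (S.basis hS).map (LinearEquiv.ofInjective (T i) (hTinj i)), hquad, fun i n => ?_⟩
  rw [DirectSum.IsInternal.collectedBasis_coe]
  simp [hT]

end Gluing

/-! ### From a chain to three quadratic summands. -/

section Decomposition

variable {F V : Type*} [Field F] [AddCommGroup V] [Module F V]

/-- `u` is the sum of three endomorphisms annihilated by `X (X - a)`, `X (X - b)`, `X (X - c)`. -/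
def IsQuadraticSum (u : Module.End F V) (a b c : F) : Prop :=
  ∃ f g h : Module.End F V, u = f + g + h ∧ f * f = a • f ∧ g * g = b • g ∧ h * h = c • h

/-- The polynomials `∏ k < n, (X - d k)`. -/
noncomputable def newtonSequence (d : ℕ → F) : Polynomial.Sequence F where
  elems' n := ∏ k ∈ Finset.range n, (X - C (d k))
  degree_eq' n := by
    rw [degree_prod]
    simp

theorem newtonSequence_succ (d : ℕ → F) (n : ℕ) :
    newtonSequence d (n + 1) = (X - C (d n)) * newtonSequence d n := by
  change ∏ k ∈ Finset.range (n + 1), (X - C (d k)) = (X - C (d n)) * ∏ k ∈ Finset.range n, _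
  rw [Finset.prod_range_succ, mul_comm]

/-- `h` keeps the even columns of `w` and `g` the odd ones. The shift sends each column kept by one
map to a vector killed by that same map, whence both quadratic relations. -/
theorem exists_add_of_basis {ι : Type*} (w : Module.End F V) (b c : F)
    (B : Module.Basis (Σ _ : ι, ℕ) F V)
    (hB : ∀ i n, w (B ⟨i, n⟩) = B ⟨i, n + 1⟩ + (if Even n then c else b) • B ⟨i, n⟩) :
    ∃ g h : Module.End F V, w = g + h ∧ g * g = b • g ∧ h * h = c • h := by
  let g : Module.End F V := B.constr F fun x : (Σ _ : ι, ℕ) =>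
    if Even x.2 then 0 else b • B x + B ⟨x.1, x.2 + 1⟩
  let h : Module.End F V := B.constr F fun x : (Σ _ : ι, ℕ) =>
    if Even x.2 then c • B x + B ⟨x.1, x.2 + 1⟩ else 0
  have hg : ∀ i n, g (B ⟨i, n⟩) = if Even n then 0 else b • B ⟨i, n⟩ + B ⟨i, n + 1⟩ :=
    fun i n => B.constr_basis F _ _
  have hh : ∀ i n, h (B ⟨i, n⟩) = if Even n then c • B ⟨i, n⟩ + B ⟨i, n + 1⟩ else 0 :=
    fun i n => B.constr_basis F _ _
  refine ⟨g, h, B.ext ?_, B.ext ?_, B.ext ?_⟩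
  · rintro ⟨i, n⟩
    rw [LinearMap.add_apply, hB, hg, hh]
    by_cases hn : Even n <;> simp [hn, add_comm]
  · rintro ⟨i, n⟩
    rw [Module.End.mul_apply, LinearMap.smul_apply, hg]
    by_cases hn : Even n
    · simp [hn]
    · have hn' : Even (n + 1) := Nat.even_add_one.2 hn
      simp [hn, hg, hn']
  · rintro ⟨i, n⟩
    rw [Module.End.mul_apply, LinearMap.smul_apply, hh]
    by_cases hn : Even n
    · have hn' : ¬ Even (n + 1) := by simpa [Nat.even_add_one] using hn
      simp only [hn, if_true, map_add, map_smul, hh, hn', if_false, add_zero]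
    · simp [hn]

theorem isQuadraticSum_of_chain {ι : Type*} [LinearOrder ι] [WellFoundedLT ι]
    (u : Module.End F V) (a b c : F) (U : ι → Submodule F V)
    (hU : ∀ i, CyclicSection u a (⨆ j < i, U j) (U i)) (htop : ⨆ i, U i = ⊤) :
    IsQuadraticSum u a b c := by
  obtain ⟨f, v, B, hf, hB⟩ := exists_basis_of_chain u a U hU htop
    (newtonSequence fun n => if Even n then c else b)
  obtain ⟨g, h, hw, hg, hh⟩ := exists_add_of_basis (u - f) b c B fun i n => by
    rw [hB, hB, newtonSequence_succ, map_mul, Module.End.mul_apply, map_sub, aeval_X, aeval_C,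
      LinearMap.sub_apply (u - f), Module.algebraMap_end_apply, sub_add_cancel]
  refine ⟨f, g, h, ?_, LinearMap.ext hf, hg, hh⟩
  rw [add_assoc, ← hw]
  abel

/-- Well-founded recursion with choice. The hypothesis lets each step use that the earlier ones were
correct. -/
theorem exists_chain {ι α : Type*} [LinearOrder ι] [WellFoundedLT ι] [CompleteLattice α]
    (Step : ι → α → α → Prop)
    (H : ∀ i (U : ι → α), (∀ j < i, Step j (⨆ k < j, U k) (U j)) →
      ∃ P, Step i (⨆ j < i, U j) P) :
    ∃ U : ι → α, ∀ i, Step i (⨆ j < i, U j) (U i) := by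
  classical
  let G : ∀ i : ι, (∀ j, j < i → α) → α := fun i r =>
    -- The default `⊥` never occurs; induction along `ι` shows this.
    if h : ∃ P, Step i (⨆ j, ⨆ hj : j < i, r j hj) P then h.choose else ⊥
  let U : ι → α := (wellFounded_lt (α := ι)).fix G
  have hU : ∀ i, U i = G i fun j _ => U j := fun i => (wellFounded_lt (α := ι)).fix_eq G i
  refine ⟨U, fun i => ?_⟩
  induction i using WellFoundedLT.induction with
  | ind i ih =>
    have h := H i U ih
    rw [hU i]
    simp only [G]
    rw [dif_pos h]
    exact h.choose_spec

end Decomposition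

/-! ### Uncountable dimension: transfinite recursion with a cardinality bound. -/

section Uncountable

variable {F V : Type*} [Field F] [AddCommGroup V] [Module F V]

/-- Otherwise `Y` is invariant and every vector of `V / Y` is an eigenvector, so `u` is a scalar `l`
there and `u - l` maps into `Y`. -/
theorem exists_notMem_sup_span_singleton (u : Module.End F V) (Y : Submodule F V)
    (h : ∀ l : F, ¬ LinearMap.range (u - l • LinearMap.id) ≤ Y) :
    ∃ x, u x ∉ Y ⊔ Submodule.span F {x} := by
  by_contra! hcon
  have hY : Y ≤ Y.comap u := by
    intro y hy
    have h1 := hcon y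
    rwa [sup_eq_left.2 ((Submodule.span_singleton_le_iff_mem y Y).2 hy)] at h1
  obtain ⟨l, hl⟩ := LinearMap.exists_eq_smul_id_of_forall_notLinearIndependent
    (f := Y.mapQ Y u hY) (by
      intro v
      obtain ⟨x, rfl⟩ := Y.mkQ_surjective v
      obtain ⟨y, hy, c, hc⟩ := Submodule.exists_of_mem_sup_span_singleton (hcon x)
      have h1 : Y.mapQ Y u hY (Y.mkQ x) = c • Y.mkQ x := by
        rw [Submodule.mkQ_apply, Submodule.mapQ_apply, ← hc]
        simp [hy]
      rw [h1, LinearIndependent.pair_iff]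
      intro h2
      have := (h2 c (-1) (by simp)).2
      simp at this)
  refine h l ?_
  rintro _ ⟨x, rfl⟩
  have h1 := LinearMap.congr_fun hl (Y.mkQ x)
  rw [← Submodule.Quotient.mk_eq_zero, LinearMap.sub_apply, Submodule.Quotient.mk_sub, sub_eq_zero]
  exact h1

theorem CyclicPart.rank_le {u : Module.End F V} {a : F} {P : Submodule F V}
    (h : CyclicPart u a P) : Module.rank F P ≤ Cardinal.aleph0 := by
  obtain ⟨f, v, -, -, -, hP, -⟩ := h
  have hle : P ≤ Submodule.span F (Set.range fun n : ℕ => ((u - f) ^ n) v) := by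
    intro z hz
    obtain ⟨p, rfl⟩ := hP z hz
    rw [aeval_eq_sum_range, LinearMap.sum_apply]
    exact Submodule.sum_mem _ fun n _ => Submodule.smul_mem _ _ (Submodule.subset_span ⟨n, rfl⟩)
  refine (Submodule.rank_mono hle).trans ((rank_span_le _).trans ?_)
  exact (Set.countable_range _).le_aleph0

theorem rank_le_rank_add_rank_map_mkQ (A P : Submodule F V) :
    Module.rank F P ≤ Module.rank F A + Module.rank F (P.map A.mkQ) := by
  have h1 := LinearMap.rank_range_add_rank_ker (A.mkQ.domRestrict P)
  rw [← h1, add_comm]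
  refine add_le_add ?_ ?_
  · have h2 : ∀ x ∈ LinearMap.ker (A.mkQ.domRestrict P), P.subtype x ∈ A := by
      intro x hx
      have : A.mkQ x = 0 := hx
      simpa using this
    refine LinearMap.rank_le_of_injective ((P.subtype.restrict h2)) ?_
    intro x y hxy
    have := congrArg Subtype.val hxy
    exact Subtype.ext (Subtype.ext this)
  · rw [LinearMap.range_domRestrict]

theorem CyclicSection.rank_le {u : Module.End F V} {a : F} {A P : Submodule F V}
    (h : CyclicSection u a A P) : Module.rank F P ≤ Module.rank F A + Cardinal.aleph0 := by
  obtain ⟨hA, -, -, hP⟩ := h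
  exact (rank_le_rank_add_rank_map_mkQ A P).trans (add_le_add le_rfl hP.rank_le)

theorem CyclicPart.cyclicSection {u : Module.End F V} {a : F} {A : Submodule F V}
    (hA : A ≤ A.comap u) {Q : Submodule F (V ⧸ A)} (hQ : CyclicPart (A.mapQ A u hA) a Q)
    (hinv : Q.map (A.mapQ A u hA) ≤ Q) : CyclicSection u a A (Q.comap A.mkQ) := by
  refine ⟨hA, fun x hx => ?_, ?_, ?_⟩
  · rw [Submodule.mem_comap, Submodule.mkQ_apply, (Submodule.Quotient.mk_eq_zero A).2 hx]
    exact zero_mem _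
  · rintro _ ⟨x, hx, rfl⟩
    exact hinv ⟨A.mkQ x, hx, rfl⟩
  · rwa [Submodule.map_comap_eq_of_surjective A.mkQ_surjective]

theorem iSup_lt_le_comap {ι : Type*} [LinearOrder ι] {u : Module.End F V} {a : F}
    {U : ι → Submodule F V} {i : ι} (h : ∀ j < i, CyclicSection u a (⨆ k < j, U k) (U j)) :
    (⨆ j < i, U j) ≤ (⨆ j < i, U j).comap u := by
  refine iSup₂_le fun j hj => ?_
  rw [← Submodule.map_le_iff_le_comap]
  obtain ⟨-, -, h1, -⟩ := h j hj
  exact h1.trans (le_iSup₂_of_le j hj le_rfl)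

theorem Submodule.exists_span_eq_mk_le_rank (W : Submodule F V) :
    ∃ s : Set V, Submodule.span F s = W ∧ Cardinal.mk s ≤ Module.rank F W := by
  let B := Module.Basis.ofVectorSpace F W
  refine ⟨W.subtype '' Set.range B, ?_, ?_⟩
  · rw [← Submodule.map_span, B.span_eq, Submodule.map_subtype_top]
  · exact Cardinal.mk_image_le.trans (Cardinal.mk_range_le.trans B.mk_eq_rank''.le)

universe w

theorem rank_iSup_lt_le {ι V : Type w} [AddCommGroup V] [Module F V] [LinearOrder ι]
    (U : ι → Submodule F V) (i : ι) {μ : Cardinal} (hμ : Cardinal.aleph0 ≤ μ)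
    (hi : Cardinal.mk (Set.Iio i) ≤ μ)
    (hU : ∀ j < i, Module.rank F (U j) ≤ μ) :
    Module.rank F (⨆ j < i, U j : Submodule F V) ≤ μ := by
  choose s hs hsμ using fun j => (U j).exists_span_eq_mk_le_rank
  have h1 : (⨆ j < i, U j) = Submodule.span F (⋃ j : Set.Iio i, s j) := by
    rw [Submodule.span_iUnion, iSup_subtype']
    exact iSup_congr fun j => (hs j).symm
  rw [h1]
  refine (rank_span_le _).trans ?_
  refine (Cardinal.mk_iUnion_le fun j : Set.Iio i => s j).trans ?_
  refine (mul_le_mul' hi (ciSup_le' fun j : Set.Iio i => (hsμ j).trans (hU j j.2))).trans ?_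
  rw [Cardinal.mul_eq_self hμ]

theorem isQuadraticSum_of_aleph0_lt_rank (u : Module.End F V) (a b c : F)
    (hV : Cardinal.aleph0 < Module.rank F V)
    (hu : ∀ l : F, Module.rank F V ≤ LinearMap.rank (u - l • (LinearMap.id : V →ₗ[F] V))) :
    IsQuadraticSum u a b c := by
  set κ := Module.rank F V with hκ
  obtain ⟨ε⟩ : Nonempty (κ.ord.ToType ≃ Module.Basis.ofVectorSpaceIndex F V) := by
    rw [← Cardinal.eq, Cardinal.mk_ord_toType, hκ]
    exact (Module.Basis.ofVectorSpace F V).mk_eq_rank''.symm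
  let e : κ.ord.ToType → V := fun i => Module.Basis.ofVectorSpace F V (ε i)
  obtain ⟨U, hU⟩ := exists_chain
    (fun (i : κ.ord.ToType) A P => CyclicSection u a A P ∧ e i ∈ P) (by
      intro i U hU
      set A := ⨆ j < i, U j with hAdef
      have hA : A ≤ A.comap u := iSup_lt_le_comap fun j hj => (hU j hj).1
      have hi : Cardinal.mk (Set.Iio i) < κ := by
        have := Cardinal.mk_Iio_lt i (by simp)
        rwa [Cardinal.mk_ord_toType] at this
      have hrank : Module.rank F A < κ := by
        -- Each section adds at most `ℵ₀` dimensions, so `μ` bounds all earlier terms. It is below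
        -- `κ` because `κ` is uncountable and the index set is its initial ordinal.
        set μ := max Cardinal.aleph0 (Cardinal.mk (Set.Iio i)) with hμ
        have hμ0 : Cardinal.aleph0 ≤ μ := le_max_left _ _
        have hUμ : ∀ j < i, Module.rank F (U j) ≤ μ := by
          intro j
          induction j using WellFoundedLT.induction with
          | ind j ih =>
            intro hj
            refine (hU j hj).1.rank_le.trans (Cardinal.add_le_of_le hμ0 ?_ hμ0)
            refine rank_iSup_lt_le U j hμ0 ?_
              fun k hk => ih k hk (hk.trans hj)
            exact (Cardinal.mk_le_mk_of_subset (Set.Iio_subset_Iio hj.le)).trans (le_max_right _ _)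
        exact (rank_iSup_lt_le U i hμ0 (le_max_right _ _) hUμ).trans_lt
          (max_lt hV hi)
      obtain ⟨Q, hQ, hQu, heQ, -⟩ := exists_cyclicPart_of_forall_fg (u := A.mapQ A u hA) a
        (N := ⊤) le_top (fun Y hY => by
          obtain ⟨x, hx⟩ := exists_notMem_sup_span_singleton (A.mapQ A u hA) Y (by
            intro l hl
            have h1 : LinearMap.range (u - l • (LinearMap.id : V →ₗ[F] V)) ≤ Y.comap A.mkQ := by
              rintro _ ⟨x, rfl⟩
              exact hl ⟨A.mkQ x, rfl⟩
            have h2 := (hu l).trans (Submodule.rank_mono h1)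
            have h3 := h2.trans (rank_le_rank_add_rank_map_mkQ A (Y.comap A.mkQ))
            rw [Submodule.map_comap_eq_of_surjective A.mkQ_surjective] at h3
            have h4 : Module.rank F Y < Cardinal.aleph0 := by
              have : Module.Finite F Y := Module.Finite.iff_fg.2 hY
              exact Module.rank_lt_aleph0 F Y
            -- If `u - l` were finite-rank modulo `A`, its rank would be below `κ`: here the absence
            -- of a dominant eigenvalue enters.
            exact absurd h3 (not_le.2 (Cardinal.add_lt_of_lt hV.le hrank (h4.trans hV))))
          exact ⟨x, trivial, hx⟩) (e := A.mkQ (e i)) trivial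
      exact ⟨_, hQ.cyclicSection hA hQu, heQ⟩)
  refine isQuadraticSum_of_chain u a b c U (fun i => (hU i).1) (top_le_iff.1 ?_)
  rw [← (Module.Basis.ofVectorSpace F V).span_eq, Submodule.span_le]
  rintro _ ⟨k, rfl⟩
  have h1 : Module.Basis.ofVectorSpace F V k = e (ε.symm k) := by simp [e]
  rw [h1]
  exact Submodule.mem_iSup_of_mem _ (hU _).2

end Uncountable

/-! ### Countable dimension, algebraic `u`: keeping a non-scalar reserve. -/

section Algebraic

variable {F V : Type*} [Field F] [AddCommGroup V] [Module F V]

/-- The smallest invariant subspace that contains `x`. -/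
noncomputable def cyclicSpan (u : Module.End F V) (x : V) : Submodule F V :=
  LinearMap.range ((LinearMap.applyₗ x).comp (aeval (R := F) u).toLinearMap)

theorem mem_cyclicSpan {u : Module.End F V} {x z : V} :
    z ∈ cyclicSpan u x ↔ ∃ p : F[X], aeval u p x = z := Iff.rfl

theorem self_mem_cyclicSpan (u : Module.End F V) (x : V) : x ∈ cyclicSpan u x :=
  ⟨1, by simp⟩

theorem map_cyclicSpan_le (u : Module.End F V) (x : V) :
    (cyclicSpan u x).map u ≤ cyclicSpan u x := by
  rintro _ ⟨_, ⟨p, rfl⟩, rfl⟩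
  exact ⟨X * p, by simp⟩

theorem aeval_apply_mem {u : Module.End F V} {W : Submodule F V} (hW : W.map u ≤ W) {x : V}
    (hx : x ∈ W) (p : F[X]) : aeval u p x ∈ W := by
  induction p using Polynomial.induction_on' with
  | add p q hp hq => rw [map_add]; exact add_mem hp hq
  | monomial n c =>
    rw [aeval_monomial, Module.End.mul_apply, Module.algebraMap_end_apply]
    refine Submodule.smul_mem _ _ ?_
    induction n with
    | zero => exact hx
    | succ n ih =>
      rw [pow_succ', Module.End.mul_apply]
      exact hW (Submodule.mem_map_of_mem ih)

theorem cyclicSpan_le {u : Module.End F V} {W : Submodule F V} (hW : W.map u ≤ W) {x : V}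
    (hx : x ∈ W) : cyclicSpan u x ≤ W := by
  rintro _ ⟨p, rfl⟩
  exact aeval_apply_mem hW hx p

theorem cyclicSpan_fg {u : Module.End F V} {x : V} {p : F[X]} (hp : p ≠ 0)
    (h : aeval u p x = 0) : (cyclicSpan u x).FG := by
  by_contra hfg
  refine aeval_apply_ne_zero_of_not_fg (fun z hz => ?_) hfg hp h
  obtain ⟨q, hq⟩ := mem_cyclicSpan.1 hz
  exact ⟨q, hq.symm⟩

theorem Submodule.FG.of_le_of_field {A B : Submodule F V} (hB : B.FG) (h : A ≤ B) : A.FG := by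
  have : Module.Finite F B := Module.Finite.iff_fg.2 hB
  exact Module.Finite.iff_fg.1 (Submodule.finiteDimensional_of_le h)

/-- The kernel of `q(u)` has a finite-dimensional complement, so `d(u)` still has infinite rank on
that kernel. -/
theorem exists_mem_ker_aeval_notMem {u : Module.End F V} {q : F[X]}
    (hq : (LinearMap.range (aeval u q)).FG) {d : F[X]} (hd : ¬ (LinearMap.range (aeval u d)).FG)
    {Z : Submodule F V} (hZ : Z.FG) : ∃ x, aeval u q x = 0 ∧ aeval u d x ∉ Z := by
  by_contra! hcon
  obtain ⟨C, hC⟩ := (LinearMap.ker (aeval u q)).exists_isCompl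
  have hCfg : C.FG := by
    refine Submodule.fg_of_fg_map_of_fg_inf_ker (aeval u q)
      (hq.of_le_of_field (LinearMap.map_le_range)) ?_
    rw [hC.symm.inf_eq_bot]
    exact Submodule.fg_bot
  refine hd (((hCfg.map (aeval u d)).sup hZ).of_le_of_field ?_)
  rw [LinearMap.range_eq_map, ← hC.sup_eq_top, Submodule.map_sup]
  refine sup_le ?_ le_sup_left
  rintro _ ⟨x, hx, rfl⟩
  exact Submodule.mem_sup_right (hcon x hx)

/-- Some cyclic subspace on which `u` is not scalar avoids `Y`. -/
theorem exists_cyclicSpan_disjoint {u : Module.End F V} {p : F[X]} (hp : p ≠ 0)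
    (hpu : aeval u p = 0) (hu : ∀ l : F, ¬ (LinearMap.range (u - l • LinearMap.id)).FG)
    {Y : Submodule F V} (hY : Y.FG) (hYu : Y.map u ≤ Y) :
    ∃ x, Disjoint (cyclicSpan u x) Y ∧ ∀ c : F, u x ≠ c • x := by
  classical
  -- `q` is of least degree among the non-zero polynomials with `q(u)` of finite rank: the minimal
  -- polynomial of `u` up to finite rank. Its degree is at least `2` since no `u - l` has finite
  -- rank.
  have hex : ∃ n, ∃ q : F[X], q ≠ 0 ∧ (LinearMap.range (aeval u q)).FG ∧ q.natDegree = n :=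
    ⟨_, p, hp, by rw [hpu, LinearMap.range_zero]; exact Submodule.fg_bot, rfl⟩
  obtain ⟨q, hq0, hq, hqn⟩ := Nat.find_spec hex
  have hmin : ∀ d : F[X], d ≠ 0 → d.natDegree < q.natDegree →
      ¬ (LinearMap.range (aeval u d)).FG := fun d hd hlt hfg =>
    Nat.find_min hex (hqn ▸ hlt) ⟨d, hd, hfg, rfl⟩
  have hqdeg : 2 ≤ q.natDegree := by
    by_contra hlt
    have h1 : q.natDegree ≤ 1 := by omega
    obtain ⟨s, t, hst⟩ := exists_eq_X_add_C_of_natDegree_le_one h1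
    by_cases hs : s = 0
    · have ht : t ≠ 0 := by
        rintro rfl
        exact hq0 (by rw [hst, hs]; simp)
      refine hu 0 (hq.of_le_of_field ?_)
      rintro _ ⟨x, rfl⟩
      refine ⟨t⁻¹ • u x, ?_⟩
      rw [hst, hs]
      simp [ht]
    · refine hu (-(s⁻¹ * t)) (hq.of_le_of_field ?_)
      rintro _ ⟨x, rfl⟩
      refine ⟨s⁻¹ • x, ?_⟩
      rw [hst, map_add, map_mul, aeval_C, aeval_C, aeval_X, LinearMap.add_apply,
        Module.End.mul_apply, Module.algebraMap_end_apply, Module.algebraMap_end_apply, map_smul,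
        smul_inv_smul₀ hs, LinearMap.sub_apply, LinearMap.smul_apply, LinearMap.id_apply,
        neg_smul, sub_neg_eq_add, smul_smul, mul_comm t]
  have key : ∀ x, (∀ g : F[X], aeval u g x ∈ Y → aeval u g x = 0) →
      (∀ c : F, aeval u (X - C c) x ∉ Y) →
      Disjoint (cyclicSpan u x) Y ∧ ∀ c : F, u x ≠ c • x := by
    intro x h1 h2
    refine ⟨?_, fun c hc => h2 c ?_⟩
    · rw [Submodule.disjoint_def]
      rintro _ ⟨g, rfl⟩ hg
      exact h1 g hg
    · rw [map_sub, aeval_X, aeval_C, LinearMap.sub_apply, Module.algebraMap_end_apply, hc, sub_self]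
      exact zero_mem _
  -- Take `x'` in the kernel of `q(u)` with `π ^ k m (u) x'` outside `Y`. Then `m(u) x'` has
  -- annihilator `π ^ (k + 1)` even modulo `Y`, so its orbit avoids `Y`; the degree being at least
  -- `2`, it is no eigenvector.
  have hprim : ∀ (π m : F[X]) (k : ℕ), Irreducible π → q = π ^ (k + 1) * m → ¬ π ∣ m →
      2 ≤ (π ^ (k + 1)).natDegree → ∃ x, Disjoint (cyclicSpan u x) Y ∧ ∀ c : F, u x ≠ c • x := by
    intro π m k hπ hqm hm hdeg
    have hm0 : m ≠ 0 := by rintro rfl; exact hm (dvd_zero _)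
    have hd0 : π ^ k * m ≠ 0 := mul_ne_zero (pow_ne_zero _ hπ.ne_zero) hm0
    have hlt : (π ^ k * m).natDegree < q.natDegree := by
      rw [hqm, pow_succ', mul_assoc, natDegree_mul hπ.ne_zero hd0]
      have := hπ.natDegree_pos
      omega
    obtain ⟨x', hx1, hx2⟩ := exists_mem_ker_aeval_notMem hq (hmin _ hd0 hlt) hY
    have hx0 : aeval u (π ^ (k + 1)) (aeval u m x') = 0 := by
      rw [← Module.End.mul_apply, ← map_mul, ← hqm, hx1]
    have claim : ∀ g : F[X], aeval u g (aeval u m x') ∈ Y → π ^ (k + 1) ∣ g := by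
      intro g hg
      by_contra hdvd
      have hg0 : g ≠ 0 := by rintro rfl; exact hdvd (dvd_zero _)
      obtain ⟨g', hgg, hg'⟩ := (FiniteMultiplicity.of_not_isUnit hπ.not_isUnit
        hg0).exists_eq_pow_mul_and_not_dvd
      set j := multiplicity π g
      have hj : j ≤ k := by
        by_contra hj
        exact hdvd (hgg ▸ (pow_dvd_pow π (by omega)).mul_right g')
      obtain ⟨s, t, hst⟩ := ((hπ.coprime_iff_not_dvd).2 hg').symm.pow_right (n := k + 1)
      refine hx2 ?_
      have h1 : π ^ k = (π ^ (k - j) * s) * g + (π ^ k * t) * π ^ (k + 1) := by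
        calc π ^ k = π ^ k * (s * g' + t * π ^ (k + 1)) := by rw [hst, mul_one]
          _ = π ^ (k - j) * π ^ j * (s * g' + t * π ^ (k + 1)) := by
            rw [pow_sub_mul_pow π hj]
          _ = (π ^ (k - j) * s) * (π ^ j * g') + (π ^ (k - j) * π ^ j) * t * π ^ (k + 1) := by ring
          _ = _ := by rw [← hgg, pow_sub_mul_pow π hj]
      have h2 : aeval u (π ^ k * m) x' = aeval u (π ^ (k - j) * s) (aeval u g (aeval u m x')) := by
        conv_lhs => rw [map_mul, Module.End.mul_apply, h1]
        rw [map_add, LinearMap.add_apply, map_mul (aeval u) (π ^ k * t), Module.End.mul_apply _ _ _,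
          hx0, map_zero, add_zero, map_mul (aeval u) _ g, Module.End.mul_apply]
      rw [h2]
      exact aeval_apply_mem hYu hg _
    refine ⟨aeval u m x', key _ (fun g hg => ?_) fun c hc => ?_⟩
    · obtain ⟨r, rfl⟩ := claim g hg
      rw [mul_comm, map_mul, Module.End.mul_apply, hx0, map_zero]
    · have h1 := natDegree_le_of_dvd (claim _ hc) (X_sub_C_ne_zero c)
      rw [natDegree_X_sub_C] at h1
      omega
  -- Either `hprim` applies to `π`, or `π` is a simple linear factor. What remains is a `q` with two
  -- distinct simple roots, where a sum of two eigenvectors works.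
  have hlin : ∀ π r : F[X], Irreducible π → q = π * r →
      (∃ x, Disjoint (cyclicSpan u x) Y ∧ ∀ c : F, u x ≠ c • x) ∨ (π.natDegree = 1 ∧ ¬ π ∣ r) := by
    intro π r hπ hqr
    by_contra! hcon
    obtain ⟨hcon1, hcon2⟩ := hcon
    obtain ⟨m, hqm, hm⟩ := (FiniteMultiplicity.of_not_isUnit hπ.not_isUnit
        hq0).exists_eq_pow_mul_and_not_dvd
    have hpos := hπ.natDegree_pos
    have hmul : 1 ≤ multiplicity π q :=
      Dvd.multiplicity_pos ⟨r, hqr⟩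
    obtain ⟨k, hk⟩ := Nat.exists_eq_add_of_le' hmul
    rw [hk] at hqm
    by_cases h2 : 2 ≤ (π ^ (k + 1)).natDegree
    · obtain ⟨x, hx1, hx2⟩ := hprim π m k hπ hqm hm h2
      obtain ⟨c, hc⟩ := hcon1 x hx1
      exact hx2 c hc
    · rw [natDegree_pow] at h2
      have hk0 : k = 0 := by
        by_contra hk0
        have : 1 * 2 ≤ (k + 1) * π.natDegree := by
          rw [mul_comm]
          exact Nat.mul_le_mul (by omega) hpos
        omega
      subst hk0
      have h3 : π.natDegree = 1 := by omega
      rw [zero_add, pow_one, hqr] at hqm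
      rw [← mul_left_cancel₀ hπ.ne_zero hqm] at hm
      exact hm (hcon2 h3)
  have hq1 : ¬ IsUnit q := fun h => by
    have := natDegree_eq_zero_of_isUnit h
    omega
  obtain ⟨π₁, hπ₁, r, hr⟩ := WfDvdMonoid.exists_irreducible_factor hq1 hq0
  rcases hlin π₁ r hπ₁ hr with h | ⟨hd₁, hr₁⟩
  · exact h
  have hr0 : r ≠ 0 := by rintro rfl; exact hr₁ (dvd_zero _)
  have hrdeg : q.natDegree = 1 + r.natDegree := by
    rw [hr, natDegree_mul hπ₁.ne_zero hr0, hd₁]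
  have hr1 : ¬ IsUnit r := fun h => by
    have := natDegree_eq_zero_of_isUnit h
    omega
  obtain ⟨π₂, hπ₂, s, hs⟩ := WfDvdMonoid.exists_irreducible_factor hr1 hr0
  have hqs : q = π₂ * (π₁ * s) := by rw [hr, hs]; ring
  rcases hlin π₂ (π₁ * s) hπ₂ hqs with h | ⟨hd₂, -⟩
  · exact h
  have hs0 : s ≠ 0 := by rintro rfl; exact hr0 (by rw [hs, mul_zero])
  have hroot : ∀ π : F[X], π.natDegree = 1 → ∃ l : F, ∃ c : F, c ≠ 0 ∧ π = C c * (X - C l) := by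
    intro π hπ
    obtain ⟨c, hc, t, hct⟩ := natDegree_eq_one.1 hπ
    refine ⟨-(c⁻¹ * t), c, hc, ?_⟩
    rw [← hct, map_neg, map_mul, sub_neg_eq_add, mul_add, ← mul_assoc, ← C_mul,
      mul_inv_cancel₀ hc, C_1, one_mul]
  obtain ⟨l₁, c₁, hc₁, hl₁⟩ := hroot π₁ hd₁
  obtain ⟨l₂, c₂, hc₂, hl₂⟩ := hroot π₂ hd₂
  have hl : l₁ ≠ l₂ := by
    rintro rfl
    refine hr₁ (Dvd.dvd.trans ?_ ⟨s, hs⟩)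
    refine ⟨C (c₁⁻¹ * c₂), ?_⟩
    rw [hl₁, hl₂, C_mul]
    have : C c₁ * C c₁⁻¹ = (1 : F[X]) := by rw [← C_mul, mul_inv_cancel₀ hc₁, C_1]
    linear_combination (-(C c₂ * (X - C l₁))) * this
  have heig : ∀ (π : F[X]) (c l : F) (d : F[X]) (x : V), c ≠ 0 → π = C c * (X - C l) →
      q = π * d → aeval u q x = 0 → ∀ g : F[X], aeval u g (aeval u d x) = g.eval l • aeval u d x := by
    intro π c l d x hc hπ hqd hx
    have h1 : aeval u (X - C l) (aeval u d x) = 0 := by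
      rw [hqd, hπ, mul_assoc, map_mul, aeval_C, Module.End.mul_apply, Module.algebraMap_end_apply,
        smul_eq_zero_iff_right hc, map_mul, Module.End.mul_apply] at hx
      exact hx
    intro g
    conv_lhs => rw [← EuclideanDomain.mod_add_div g (X - C l)]
    rw [mod_X_sub_C_eq_C_eval, map_add, LinearMap.add_apply, aeval_C,
      Module.algebraMap_end_apply, mul_comm, map_mul, Module.End.mul_apply, h1, map_zero, add_zero]
  have hπs0 : π₁ * s ≠ 0 := mul_ne_zero hπ₁.ne_zero hs0
  have hπsdeg : q.natDegree = 1 + (π₁ * s).natDegree := by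
    rw [hqs, natDegree_mul hπ₂.ne_zero hπs0, hd₂]
  obtain ⟨z₁, hz₁, hx₁⟩ := exists_mem_ker_aeval_notMem hq (hmin r hr0 (by omega)) hY
  obtain ⟨z₂, hz₂, hx₂⟩ := exists_mem_ker_aeval_notMem hq (hmin _ hπs0 (by omega))
    (hY.sup (Submodule.fg_span_singleton (aeval u r z₁)))
  have he₁ := heig π₁ c₁ l₁ r z₁ hc₁ hl₁ hr hz₁
  have he₂ := heig π₂ c₂ l₂ (π₁ * s) z₂ hc₂ hl₂ hqs hz₂
  set x₁ := aeval u r z₁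
  set x₂ := aeval u (π₁ * s) z₂
  -- The eigenvectors `x₁`, `x₂` were chosen independent modulo `Y`.
  have claim : ∀ g : F[X], aeval u g (x₁ + x₂) ∈ Y → g.eval l₁ = 0 ∧ g.eval l₂ = 0 := by
    intro g hg
    rw [map_add, he₁, he₂] at hg
    have h2 : g.eval l₂ = 0 := by
      by_contra h2
      refine hx₂ ?_
      have h3 : x₂ = (g.eval l₂)⁻¹ • ((g.eval l₁ • x₁ + g.eval l₂ • x₂) - g.eval l₁ • x₁) := by
        rw [add_sub_cancel_left, inv_smul_smul₀ h2]
      rw [h3]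
      exact Submodule.smul_mem _ _ (sub_mem (Submodule.mem_sup_left hg) (Submodule.mem_sup_right
        (Submodule.smul_mem _ _ (Submodule.mem_span_singleton_self _))))
    refine ⟨?_, h2⟩
    by_contra h1
    rw [h2, zero_smul, add_zero] at hg
    exact hx₁ ((Submodule.smul_mem_iff Y h1).1 hg)
  refine ⟨x₁ + x₂, key _ (fun g hg => ?_) fun c hc => ?_⟩
  · rw [map_add, he₁, he₂, (claim g hg).1, (claim g hg).2, zero_smul, zero_smul, add_zero]
  · obtain ⟨h1, h2⟩ := claim _ hc
    rw [eval_sub, eval_X, eval_C, sub_eq_zero] at h1 h2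
    exact hl (h1.trans h2.symm)

/-- Two disjoint invariant subspaces `N` and `R` are grown in parallel, each acquiring ever new
non-scalar behaviour. The cyclic part `P` is built inside `N`, so `R` survives in `V / P` and keeps
the quotient non-scalar up to finite rank. -/
theorem exists_cyclicPart_of_aeval_eq_zero {u : Module.End F V} {p : F[X]} (hp : p ≠ 0)
    (hpu : aeval u p = 0) (hu : ∀ l : F, ¬ (LinearMap.range (u - l • LinearMap.id)).FG)
    (a : F) (e : V) :
    ∃ P, CyclicPart u a P ∧ P.map u ≤ P ∧ e ∈ P ∧
      ∀ l : F, ¬ (LinearMap.range (P.mkQ ∘ₗ (u - l • LinearMap.id))).FG := by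
  let Pair := {s : Submodule F V × Submodule F V // s.1.FG ∧ s.2.FG ∧ s.1.map u ≤ s.1 ∧
    s.2.map u ≤ s.2 ∧ Disjoint s.1 s.2}
  have hfg : ∀ x, (cyclicSpan u x).FG := fun x => cyclicSpan_fg hp (by rw [hpu]; rfl)
  have grow : ∀ A B : Submodule F V, A.FG → B.FG → A.map u ≤ A → B.map u ≤ B → Disjoint A B →
      ∃ x, Disjoint (A ⊔ cyclicSpan u x) B ∧ u x ∉ A ⊔ Submodule.span F {x} := by
    intro A B hA hB hAu hBu hAB
    have hinv : (A ⊔ B).map u ≤ A ⊔ B := by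
      rw [Submodule.map_sup]
      exact sup_le_sup hAu hBu
    obtain ⟨x, h1, h2⟩ := exists_cyclicSpan_disjoint hp hpu hu (hA.sup hB) hinv
    refine ⟨x, ?_, fun hx => ?_⟩
    · rw [sup_comm]
      exact hAB.disjoint_sup_left_of_disjoint_sup_right h1
    · obtain ⟨y, hy, c, hc⟩ := Submodule.exists_of_mem_sup_span_singleton hx
      have hux : u x - c • x ∈ cyclicSpan u x :=
        sub_mem (map_cyclicSpan_le u x (Submodule.mem_map_of_mem (self_mem_cyclicSpan u x)))
          (Submodule.smul_mem _ _ (self_mem_cyclicSpan u x))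
      have hy' : u x - c • x = y := by rw [← hc]; abel
      have := Submodule.disjoint_def.1 h1 _ hux (hy'.symm ▸ Submodule.mem_sup_left hy)
      exact h2 c (sub_eq_zero.1 this)
  have step : ∀ s : Pair, ∃ t : Pair, s.1.1 ≤ t.1.1 ∧ s.1.2 ≤ t.1.2 ∧
      (∃ x ∈ t.1.1, u x ∉ s.1.1 ⊔ Submodule.span F {x}) ∧
      ∃ y ∈ t.1.2, u y ∉ s.1.2 ⊔ Submodule.span F {y} := by
    rintro ⟨⟨A, B⟩, hA, hB, hAu, hBu, hAB⟩
    have hsup : ∀ (W : Submodule F V) x, W.map u ≤ W →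
        (W ⊔ cyclicSpan u x).map u ≤ W ⊔ cyclicSpan u x := by
      intro W x hW
      rw [Submodule.map_sup]
      exact sup_le_sup hW (map_cyclicSpan_le u x)
    obtain ⟨x, hx1, hx2⟩ := grow A B hA hB hAu hBu hAB
    obtain ⟨y, hy1, hy2⟩ := grow B (A ⊔ cyclicSpan u x) hB (hA.sup (hfg x)) hBu (hsup A x hAu)
      hx1.symm
    exact ⟨⟨⟨A ⊔ cyclicSpan u x, B ⊔ cyclicSpan u y⟩, hA.sup (hfg x), hB.sup (hfg y), hsup A x hAu,
      hsup B y hBu, hy1.symm⟩, le_sup_left, le_sup_left,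
      ⟨x, Submodule.mem_sup_right (self_mem_cyclicSpan u x), hx2⟩,
      ⟨y, Submodule.mem_sup_right (self_mem_cyclicSpan u y), hy2⟩⟩
  choose nxt hn1 hn2 hn3 hn4 using step
  let s₀ : Pair := ⟨⟨cyclicSpan u e, ⊥⟩, hfg e, Submodule.fg_bot, map_cyclicSpan_le u e,
    by simp, disjoint_bot_right⟩
  let s : ℕ → Pair := fun n => Nat.rec s₀ (fun _ => nxt) n
  have hs : ∀ n, s (n + 1) = nxt (s n) := fun n => rfl
  have hX : Monotone fun n => (s n).1.1 := monotone_nat_of_le_succ fun n => hn1 (s n)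
  have hY : Monotone fun n => (s n).1.2 := monotone_nat_of_le_succ fun n => hn2 (s n)
  set N := ⨆ n, (s n).1.1 with hN
  set R := ⨆ n, (s n).1.2 with hR
  have hNu : N.map u ≤ N := by
    rw [hN, Submodule.map_iSup]
    exact iSup_mono fun n => (s n).2.2.2.1
  have hRu : R.map u ≤ R := by
    rw [hR, Submodule.map_iSup]
    exact iSup_mono fun n => (s n).2.2.2.2.1
  have hNR : Disjoint N R := by
    rw [Submodule.disjoint_def]
    intro z hzN hzR
    obtain ⟨m, hm⟩ := (Submodule.mem_iSup_of_directed _ hX.directed_le).1 hzN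
    obtain ⟨n, hn⟩ := (Submodule.mem_iSup_of_directed _ hY.directed_le).1 hzR
    exact Submodule.disjoint_def.1 (s (max m n)).2.2.2.2.2 z (hX (le_max_left m n) hm)
      (hY (le_max_right m n) hn)
  obtain ⟨P, h1, h2, h3, h4⟩ := exists_cyclicPart_of_forall_fg (u := u) a hNu (fun Y hYfg => by
    obtain ⟨n, hn⟩ := (hYfg.of_le_of_field (inf_le_left (b := N))).exists_le_of_le_iSup hX
      inf_le_right
    obtain ⟨x, hx, hux⟩ := hn3 (s n)
    have hxN : x ∈ N := Submodule.mem_iSup_of_mem (n + 1) hx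
    refine ⟨x, hxN, fun hcon => hux ?_⟩
    obtain ⟨y, hy, c, hc⟩ := Submodule.exists_of_mem_sup_span_singleton hcon
    have hyN : y ∈ N := by
      have : y = u x - c • x := by rw [← hc]; abel
      rw [this]
      exact sub_mem (hNu (Submodule.mem_map_of_mem hxN)) (Submodule.smul_mem _ _ hxN)
    rw [← hc]
    exact add_mem (Submodule.mem_sup_left (hn ⟨hy, hyN⟩)) (Submodule.mem_sup_right
      (Submodule.smul_mem _ _ (Submodule.mem_span_singleton_self x))))
    (e := e) (Submodule.mem_iSup_of_mem 0 (self_mem_cyclicSpan u e))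
  refine ⟨P, h1, h2, h3, fun l hl => ?_⟩
  have hR' : R.map (u - l • LinearMap.id) ≤ R := by
    rintro _ ⟨z, hz, rfl⟩
    exact sub_mem (hRu (Submodule.mem_map_of_mem hz)) (Submodule.smul_mem _ _ hz)
  -- `R` embeds in `V / P`, so `(u - l) R` would be finite-dimensional, hence inside one finite
  -- level of `R`; the vector `y` added at the next level contradicts this.
  have hR'fg : (R.map (u - l • LinearMap.id)).FG := by
    refine Submodule.fg_of_fg_map_of_fg_inf_ker P.mkQ (hl.of_le_of_field ?_) ?_
    · rw [← Submodule.map_comp]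
      exact LinearMap.map_le_range
    · rw [Submodule.ker_mkQ, ((hNR.symm.mono_left hR').mono_right h4).eq_bot]
      exact Submodule.fg_bot
  obtain ⟨n, hn⟩ := hR'fg.exists_le_of_le_iSup hY hR'
  obtain ⟨y, hy, huy⟩ := hn4 (s n)
  refine huy ?_
  have hyR : y ∈ R := Submodule.mem_iSup_of_mem (n + 1) hy
  have h5 := hn ⟨y, hyR, rfl⟩
  have h6 : u y = (u - l • (LinearMap.id : V →ₗ[F] V)) y + l • y := by simp
  rw [h6]
  exact add_mem (Submodule.mem_sup_left h5) (Submodule.mem_sup_right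
      (Submodule.smul_mem _ _ (Submodule.mem_span_singleton_self y)))

theorem aeval_mapQ_mkQ {u : Module.End F V} {A : Submodule F V} (hA : A ≤ A.comap u)
    (p : F[X]) (x : V) : aeval (A.mapQ A u hA) p (A.mkQ x) = A.mkQ (aeval u p x) := by
  induction p using Polynomial.induction_on' with
  | add p q hp hq => simp only [map_add, LinearMap.add_apply, hp, hq]
  | monomial n c =>
    rw [aeval_monomial, aeval_monomial, Module.End.mul_apply, Module.End.mul_apply,
      Module.algebraMap_end_apply, Module.algebraMap_end_apply, map_smul]
    congr 1
    induction n with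
    | zero => rfl
    | succ n ih => rw [pow_succ', pow_succ', Module.End.mul_apply, Module.End.mul_apply, ih]; rfl

theorem aeval_mapQ_eq_zero {u : Module.End F V} {A : Submodule F V} (hA : A ≤ A.comap u)
    {p : F[X]} {x : V} (h : aeval u p x ∈ A) : aeval (A.mapQ A u hA) p (A.mkQ x) = 0 := by
  rw [aeval_mapQ_mkQ, Submodule.mkQ_apply, Submodule.Quotient.mk_eq_zero]
  exact h

theorem isQuadraticSum_of_aeval_eq_zero (u : Module.End F V) (a b c : F) {p : F[X]} (hp : p ≠ 0)
    (hpu : aeval u p = 0) (hu : ∀ l : F, ¬ (LinearMap.range (u - l • LinearMap.id)).FG)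
    (e : ℕ → V) (he : Submodule.span F (Set.range e) = ⊤) : IsQuadraticSum u a b c := by
  obtain ⟨U, hU⟩ := exists_chain (fun (i : ℕ) A P => CyclicSection u a A P ∧ e i ∈ P ∧
      ∀ l : F, ¬ (LinearMap.range (P.mkQ ∘ₗ (u - l • LinearMap.id))).FG) (by
    intro i U hU
    set A := ⨆ j < i, U j with hAdef
    have hA : A ≤ A.comap u := iSup_lt_le_comap fun j hj => (hU j hj).1
    have hAnd : ∀ l : F, ¬ (LinearMap.range (A.mkQ ∘ₗ (u - l • LinearMap.id))).FG := by
      cases i with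
      | zero =>
        intro l hl
        refine hu l (Submodule.fg_of_fg_map_of_fg_inf_ker A.mkQ ?_ ?_)
        · rwa [← LinearMap.range_comp]
        · have : A = ⊥ := by simp [hAdef]
          rw [Submodule.ker_mkQ, this, inf_bot_eq]
          exact Submodule.fg_bot
      | succ k =>
        -- The chain is increasing, so the join of the earlier terms is the last one, for which the
        -- non-scalar condition was recorded.
        have hAk : A = U k := by
          refine le_antisymm (iSup₂_le fun j hj => ?_) (le_iSup₂_of_le k (Nat.lt_succ_self k) le_rfl)
          rcases (Nat.lt_succ_iff.1 hj).eq_or_lt with rfl | hjk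
          · exact le_rfl
          · obtain ⟨-, h1, -⟩ := (hU k (Nat.lt_succ_self k)).1
            exact (le_iSup₂_of_le j hjk le_rfl).trans h1
        rw [hAk]
        exact (hU k (Nat.lt_succ_self k)).2.2
    have hpA : aeval (A.mapQ A u hA) p = 0 := by
      ext x
      exact aeval_mapQ_eq_zero hA (by rw [hpu]; exact zero_mem _)
    obtain ⟨Q, h1, h2, h3, h4⟩ := exists_cyclicPart_of_aeval_eq_zero hp hpA (fun l hl => by
      refine hAnd l (hl.of_le_of_field ?_)
      rintro _ ⟨x, rfl⟩
      exact ⟨A.mkQ x, rfl⟩) a (A.mkQ (e i))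
    refine ⟨Q.comap A.mkQ, h1.cyclicSection hA h2, h3, fun l hl => h4 l ?_⟩
    have h5 := hl.map ((Q.comap A.mkQ).mapQ Q A.mkQ le_rfl)
    refine h5.of_le_of_field ?_
    rintro _ ⟨x, rfl⟩
    obtain ⟨x, rfl⟩ := A.mkQ_surjective x
    exact ⟨_, ⟨x, rfl⟩, rfl⟩)
  refine isQuadraticSum_of_chain u a b c U (fun i => (hU i).1) (top_le_iff.1 ?_)
  rw [← he, Submodule.span_le]
  rintro _ ⟨k, rfl⟩
  exact Submodule.mem_iSup_of_mem k (hU k).2.1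

end Algebraic

/-! ### Countable dimension, torsion but not algebraic `u`. -/

section Torsion

variable {F V : Type*} [Field F] [AddCommGroup V] [Module F V]

theorem aeval_mul_apply (u : Module.End F V) (p q : F[X]) (x : V) :
    aeval u (p * q) x = aeval u p (aeval u q x) := by
  rw [map_mul, Module.End.mul_apply]

theorem aeval_apply_comm (u : Module.End F V) (p q : F[X]) (x : V) :
    aeval u p (aeval u q x) = aeval u q (aeval u p x) := by
  rw [← aeval_mul_apply, mul_comm, aeval_mul_apply]

/-- A torsion endomorphism whose local annihilators have bounded degree is algebraic. -/
theorem exists_aeval_eq_zero_of_natDegree_le {u : Module.End F V} {n : ℕ}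
    (h : ∀ x, ∃ p : F[X], p ≠ 0 ∧ p.natDegree ≤ n ∧ aeval u p x = 0) :
    ∃ p : F[X], p ≠ 0 ∧ aeval u p = 0 := by
  classical
  have hmin : ∀ x, ∃ p : F[X], p ≠ 0 ∧ p.natDegree ≤ n ∧ aeval u p x = 0 ∧
      ∀ g : F[X], aeval u g x = 0 → p ∣ g := by
    intro x
    have hex : ∃ d, ∃ p : F[X], p ≠ 0 ∧ p.natDegree = d ∧ p.natDegree ≤ n ∧ aeval u p x = 0 := by
      obtain ⟨p, h1, h2, h3⟩ := h x
      exact ⟨_, p, h1, rfl, h2, h3⟩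
    obtain ⟨p, h1, h2, h3, h4⟩ := Nat.find_spec hex
    refine ⟨p, h1, h3, h4, fun g hg => ?_⟩
    rw [← EuclideanDomain.mod_eq_zero]
    by_contra hne
    have hlt : (g % p).natDegree < p.natDegree :=
      natDegree_lt_natDegree hne (EuclideanDomain.mod_lt g h1)
    refine Nat.find_min hex (h2 ▸ hlt) ⟨g % p, hne, rfl, hlt.le.trans h3, ?_⟩
    rw [← EuclideanDomain.mod_add_div g p, map_add, LinearMap.add_apply, mul_comm p, map_mul,
      Module.End.mul_apply, h4, map_zero, add_zero] at hg
    exact hg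
  choose m hm0 hmn hmx hmd using hmin
  -- The local annihilator of largest degree kills everything. If `m y` does not divide it, some
  -- prime `π` has a larger exponent `k` in `m y`; combining the `π`-part from `y` with the
  -- prime-to-`π` part of `x` yields a vector with a bigger annihilator.
  obtain ⟨x, hx⟩ : ∃ x, ∀ z, (m z).natDegree ≤ (m x).natDegree := by
    have hbdd : BddAbove (Set.range fun x => (m x).natDegree) :=
      ⟨n, by rintro _ ⟨x, rfl⟩; exact hmn x⟩
    obtain ⟨x, hx⟩ := Nat.sSup_mem (Set.range_nonempty fun x => (m x).natDegree) hbdd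
    exact ⟨x, fun z => (le_csSup hbdd ⟨z, rfl⟩).trans hx.ge⟩
  refine ⟨m x, hm0 x, LinearMap.ext fun y => ?_⟩
  by_contra hy
  have hdvd : ¬ m y ∣ m x := by
    rintro ⟨r, hr⟩
    refine hy ?_
    rw [hr, mul_comm, map_mul, Module.End.mul_apply, hmx, map_zero, LinearMap.zero_apply]
  rw [UniqueFactorizationMonoid.dvd_iff_emultiplicity_le (hm0 y)] at hdvd
  push Not at hdvd
  obtain ⟨π, hπ, hlt⟩ := hdvd
  have hπi := hπ.irreducible
  have hfy := FiniteMultiplicity.of_not_isUnit hπi.not_isUnit (hm0 y)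
  have hfx := FiniteMultiplicity.of_not_isUnit hπi.not_isUnit (hm0 x)
  rw [hfy.emultiplicity_eq_multiplicity, hfx.emultiplicity_eq_multiplicity, Nat.cast_lt] at hlt
  obtain ⟨b, hb, -⟩ := hfy.exists_eq_pow_mul_and_not_dvd
  obtain ⟨c, hc, hcπ⟩ := hfx.exists_eq_pow_mul_and_not_dvd
  set j := multiplicity π (m x)
  set k := multiplicity π (m y)
  have hb0 : b ≠ 0 := by rintro rfl; exact hm0 y (by rw [hb, mul_zero])
  have hc0 : c ≠ 0 := by rintro rfl; exact hm0 x (by rw [hc, mul_zero])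
  have hcop : IsCoprime (π ^ k) c := ((hπi.coprime_iff_not_dvd).2 hcπ).pow_left
  have h1 : ∀ g : F[X], aeval u g (aeval u b y) = 0 → π ^ k ∣ g := by
    intro g hg
    rw [← Module.End.mul_apply, ← map_mul] at hg
    have := hmd y _ hg
    rw [hb] at this
    exact (mul_dvd_mul_iff_right hb0).1 this
  have h2 : ∀ g : F[X], aeval u g (aeval u (π ^ j) x) = 0 → c ∣ g := by
    intro g hg
    rw [← Module.End.mul_apply, ← map_mul, mul_comm] at hg
    have := hmd x _ hg
    rw [hc] at this
    exact (mul_dvd_mul_iff_left (pow_ne_zero j hπi.ne_zero)).1 this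
  have h3 : aeval u (π ^ k) (aeval u b y) = 0 := by
    rw [← Module.End.mul_apply, ← map_mul, ← hb, hmx]
  have h4 : aeval u c (aeval u (π ^ j) x) = 0 := by
    rw [← Module.End.mul_apply, ← map_mul, mul_comm, ← hc, hmx]
  have h5 : π ^ k * c ∣ m (aeval u (π ^ j) x + aeval u b y) := by
    set g := m (aeval u (π ^ j) x + aeval u b y) with hg
    have h6 : aeval u g (aeval u (π ^ j) x) + aeval u g (aeval u b y) = 0 := by
      rw [← map_add, hg, hmx]
    have h7 : π ^ k ∣ g := by
      refine hcop.dvd_of_dvd_mul_right (h1 (g * c) ?_)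
      have h8 := congrArg (aeval u c) h6
      rw [map_add, map_zero, aeval_apply_comm u c g, h4, map_zero, zero_add,
        aeval_apply_comm u c g] at h8
      rw [aeval_mul_apply]
      exact h8
    refine hcop.mul_dvd h7 (h2 g ?_)
    obtain ⟨r, hr⟩ := h7
    have h8 : aeval u g (aeval u b y) = 0 := by
      rw [hr, mul_comm, aeval_mul_apply, h3, map_zero]
    rwa [h8, add_zero] at h6
  have h6 := natDegree_le_of_dvd h5 (hm0 _)
  have h7 := hx (aeval u (π ^ j) x + aeval u b y)
  rw [natDegree_mul (pow_ne_zero _ hπi.ne_zero) hc0, natDegree_pow] at h6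
  have h8 : (m x).natDegree = j * π.natDegree + c.natDegree := by
    rw [hc, natDegree_mul (pow_ne_zero _ hπi.ne_zero) hc0, natDegree_pow]
  have h9 := hπi.natDegree_pos
  have h10 : j * π.natDegree < k * π.natDegree := Nat.mul_lt_mul_of_pos_right hlt h9
  omega

/-- The subspaces `U + u U + ... + u ^ n U`. -/
def growSpan (u : Module.End F V) (U : Submodule F V) : ℕ → Submodule F V
  | 0 => U
  | n + 1 => growSpan u U n ⊔ (growSpan u U n).map u

theorem growSpan_mono (u : Module.End F V) (U : Submodule F V) : Monotone (growSpan u U) :=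
  monotone_nat_of_le_succ fun _ => le_sup_left

theorem map_iSup_growSpan_le (u : Module.End F V) (U : Submodule F V) :
    (⨆ n, growSpan u U n).map u ≤ ⨆ n, growSpan u U n := by
  rw [Submodule.map_iSup]
  exact iSup_le fun n => le_sup_right.trans (le_iSup (growSpan u U) (n + 1))

theorem growSpan_le {u : Module.End F V} {U W : Submodule F V} (hU : U ≤ W) (hW : W.map u ≤ W)
    (n : ℕ) : growSpan u U n ≤ W := by
  induction n with
  | zero => exact hU
  | succ n ih => exact sup_le ih ((Submodule.map_mono ih).trans hW)

/-- Repeated advancing, with two outcomes: `G` is swallowed, or the orbit closes up first and a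
connection is needed. -/
theorem IsStage.exists_advance_ge {u : Module.End F V} {a : F} {v : V} {f : Module.End F V}
    {U : Submodule F V} (h : IsStage u a v f U) {G : Submodule F V} (hG : G.FG)
    (hGU : G ≤ ⨆ n, growSpan u U n) :
    ∃ f' U', (∀ z ∈ U, f' z = f z) ∧ U ≤ U' ∧ U' ≤ (⨆ n, growSpan u U n) ∧
      IsStage u a v f' U' ∧ (G ≤ U' ∨ (U' ⊔ U'.map u).map u ≤ U' ⊔ U'.map u) := by
  have hUW : U ≤ ⨆ n, growSpan u U n := le_iSup (growSpan u U) 0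
  have hW := map_iSup_growSpan_le u U
  obtain ⟨n, hn⟩ := hG.exists_le_of_le_iSup (growSpan_mono u U) hGU
  have key : ∀ n, ∃ f' U', (∀ z ∈ U, f' z = f z) ∧ U ≤ U' ∧ U' ≤ (⨆ n, growSpan u U n) ∧
      IsStage u a v f' U' ∧
      (growSpan u U n ≤ U' ∨ (U' ⊔ U'.map u).map u ≤ U' ⊔ U'.map u) := by
    intro n
    induction n with
    | zero => exact ⟨f, U, fun _ _ => rfl, le_rfl, hUW, h, Or.inl le_rfl⟩
    | succ n ih =>
      obtain ⟨f', U', h1, h2, h3, h4, h5⟩ := ih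
      by_cases hinv : (U' ⊔ U'.map u).map u ≤ U' ⊔ U'.map u
      · exact ⟨f', U', h1, h2, h3, h4, Or.inr hinv⟩
      · have h5 := h5.resolve_right hinv
        obtain ⟨f'', h6, h7⟩ := h4.exists_advance hinv
        refine ⟨f'', _, fun z hz => (h6 z (h2 hz)).trans (h1 z hz), h2.trans le_sup_left,
          sup_le h3 ((Submodule.map_mono h3).trans hW), h7, Or.inl ?_⟩
        exact sup_le_sup h5 (Submodule.map_mono h5)
  obtain ⟨f', U', h1, h2, h3, h4, h5⟩ := key n
  exact ⟨f', U', h1, h2, h3, h4, h5.imp_left hn.trans⟩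

theorem exists_fg_invariant_ge {u : Module.End F V}
    (h : ∀ x, ∃ p : F[X], p ≠ 0 ∧ aeval u p x = 0) {G : Submodule F V} (hG : G.FG) :
    ∃ W : Submodule F V, W.FG ∧ W.map u ≤ W ∧ G ≤ W := by
  induction G, hG using Submodule.fg_induction with
  | singleton x =>
    obtain ⟨p, hp, hpx⟩ := h x
    exact ⟨cyclicSpan u x, cyclicSpan_fg hp hpx, map_cyclicSpan_le u x,
      (Submodule.span_singleton_le_iff_mem _ _).2 (self_mem_cyclicSpan u x)⟩
  | sup A B _ _ ihA ihB =>
    obtain ⟨W, h1, h2, h3⟩ := ihA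
    obtain ⟨W', h1', h2', h3'⟩ := ihB
    exact ⟨W ⊔ W', h1.sup h1', by rw [Submodule.map_sup]; exact sup_le_sup h2 h2',
      sup_le_sup h3 h3'⟩

theorem exists_aeval_map_eq_bot {u : Module.End F V}
    (h : ∀ x, ∃ p : F[X], p ≠ 0 ∧ aeval u p x = 0) {G : Submodule F V} (hG : G.FG) :
    ∃ p : F[X], p ≠ 0 ∧ ∀ x ∈ G, aeval u p x = 0 := by
  induction G, hG using Submodule.fg_induction with
  | singleton x =>
    obtain ⟨p, hp, hpx⟩ := h x
    refine ⟨p, hp, fun z hz => ?_⟩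
    obtain ⟨c, rfl⟩ := Submodule.mem_span_singleton.1 hz
    rw [map_smul, hpx, smul_zero]
  | sup A B _ _ ihA ihB =>
    obtain ⟨p, hp, hpA⟩ := ihA
    obtain ⟨q, hq, hqB⟩ := ihB
    refine ⟨p * q, mul_ne_zero hp hq, fun z hz => ?_⟩
    obtain ⟨x, hx, y, hy, rfl⟩ := Submodule.mem_sup.1 hz
    rw [map_add, map_mul (aeval u), Module.End.mul_apply _ _ y, hqB y hy, map_zero, add_zero,
      ← map_mul, mul_comm, map_mul, Module.End.mul_apply, hpA x hx, map_zero]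

theorem exists_add_aeval_of_mem_growSpan {u : Module.End F V} {Y : Submodule F V}
    (hYu : Y.map u ≤ Y) (x : V) (n : ℕ) :
    ∀ z ∈ growSpan u (Y ⊔ Submodule.span F {x}) n, ∃ y ∈ Y, ∃ p : F[X], p.natDegree ≤ n ∧
      y + aeval u p x = z := by
  induction n with
  | zero =>
    intro z hz
    obtain ⟨y, hy, c, rfl⟩ := Submodule.exists_of_mem_sup_span_singleton hz
    exact ⟨y, hy, C c, by simp, by simp⟩
  | succ n ih =>
    intro z hz
    obtain ⟨z₁, hz₁, _, ⟨z₂, hz₂, rfl⟩, rfl⟩ := Submodule.mem_sup.1 hz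
    obtain ⟨y₁, hy₁, p₁, hp₁, rfl⟩ := ih z₁ hz₁
    obtain ⟨y₂, hy₂, p₂, hp₂, rfl⟩ := ih z₂ hz₂
    refine ⟨y₁ + u y₂, add_mem hy₁ (hYu (Submodule.mem_map_of_mem hy₂)), p₁ + X * p₂, ?_, ?_⟩
    · refine (natDegree_add_le _ _).trans (max_le (hp₁.trans (Nat.le_succ n)) ?_)
      refine natDegree_mul_le.trans ?_
      have := natDegree_X_le (R := F)
      omega
    · rw [map_add (aeval u), LinearMap.add_apply, aeval_mul_apply, aeval_X, map_add]
      abel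

/-- For a torsion endomorphism that is not algebraic, some vector has at least four independent
iterates modulo `Y`. -/
theorem exists_growSpan_two_not_invariant {u : Module.End F V}
    (h : ∀ x, ∃ p : F[X], p ≠ 0 ∧ aeval u p x = 0) (hu : ∀ p : F[X], p ≠ 0 → aeval u p ≠ 0)
    {Y : Submodule F V} (hY : Y.FG) (hYu : Y.map u ≤ Y) :
    ∃ x, ¬ (growSpan u (Y ⊔ Submodule.span F {x}) 2).map u ≤
      growSpan u (Y ⊔ Submodule.span F {x}) 2 := by
  by_contra! hcon
  have hY' : Y ≤ Y.comap u := Submodule.map_le_iff_le_comap.1 hYu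
  obtain ⟨p, hp, hpY⟩ : ∃ p : F[X], p ≠ 0 ∧ aeval (Y.mapQ Y u hY') p = 0 := by
    -- If the second growth is always invariant, it expresses `u ^ 3 x` modulo `Y` by a polynomial
    -- of degree at most `2` in `u`, which bounds the local annihilators on `V / Y` by degree `3`.
    refine exists_aeval_eq_zero_of_natDegree_le (n := 3) fun z => ?_
    obtain ⟨x, rfl⟩ := Y.mkQ_surjective z
    have hx : x ∈ growSpan u (Y ⊔ Submodule.span F {x}) 2 :=
      growSpan_mono u _ (Nat.zero_le 2)
        (Submodule.mem_sup_right (Submodule.mem_span_singleton_self x))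
    obtain ⟨y, hy, p, hp, hyp⟩ := exists_add_aeval_of_mem_growSpan hYu x 2 _
      (aeval_apply_mem (hcon x) hx (X ^ 3))
    refine ⟨X ^ 3 - p, fun h0 => ?_, ?_, aeval_mapQ_eq_zero hY' ?_⟩
    · rw [sub_eq_zero] at h0
      rw [← h0, natDegree_X_pow] at hp
      omega
    · refine (natDegree_sub_le _ _).trans ?_
      rw [natDegree_X_pow]
      exact max_le le_rfl (hp.trans (by norm_num))
    · rw [map_sub, LinearMap.sub_apply, ← hyp, add_sub_cancel_right]
      exact hy
  obtain ⟨q, hq, hqY⟩ := exists_aeval_map_eq_bot h hY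
  refine hu (q * p) (mul_ne_zero hq hp) (LinearMap.ext fun x => ?_)
  rw [aeval_mul_apply]
  refine hqY _ ?_
  rw [← Submodule.Quotient.mk_eq_zero, ← Submodule.mkQ_apply, ← aeval_mapQ_mkQ hY', hpY]
  rfl

/-- A torsion endomorphism of a countable-dimensional space that is not algebraic can be made
cyclic. -/
theorem cyclicPart_top_of_torsion {u : Module.End F V} (a : F)
    (h : ∀ x, ∃ p : F[X], p ≠ 0 ∧ aeval u p x = 0) (hu : ∀ p : F[X], p ≠ 0 → aeval u p ≠ 0)
    {t : ℕ → V} (ht : Submodule.span F (Set.range t) = ⊤) : CyclicPart u a ⊤ := by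
  -- Such an `x` serves for connecting and also leaves enough room afterwards for `exists_insert`.
  have long : ∀ {Y : Submodule F V}, Y.FG → Y.map u ≤ Y →
      ∃ x, u x ∉ Y ⊔ Submodule.span F {x} ∧
        ¬ (growSpan u (Y ⊔ Submodule.span F {x}) 2).map u ≤
          growSpan u (Y ⊔ Submodule.span F {x}) 2 := by
    intro Y hY hYu
    obtain ⟨x, hx⟩ := exists_growSpan_two_not_invariant h hu hY hYu
    refine ⟨x, fun hux => hx ?_, hx⟩
    have hinv : (Y ⊔ Submodule.span F {x}).map u ≤ Y ⊔ Submodule.span F {x} := by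
      rw [Submodule.map_sup, Submodule.map_span, Set.image_singleton]
      exact sup_le (hYu.trans le_sup_left) ((Submodule.span_singleton_le_iff_mem _ _).2 hux)
    have heq : growSpan u (Y ⊔ Submodule.span F {x}) 2 = Y ⊔ Submodule.span F {x} :=
      le_antisymm (growSpan_le le_rfl hinv 2) (growSpan_mono u _ (Nat.zero_le 2))
    rwa [heq]
  have close : ∀ v f U, IsStage u a v f U → ∃ f' U', (∀ z ∈ U, f' z = f z) ∧ U ≤ U' ∧
      IsStage u a v f' U' ∧ (U' ⊔ U'.map u).map u ≤ U' ⊔ U'.map u := by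
    intro v f U hs
    obtain ⟨W, hW, hWu, hUW⟩ := exists_fg_invariant_ge h hs.chain.fg
    have hfg : (⨆ n, growSpan u U n).FG :=
      hW.of_le_of_field (iSup_le fun n => growSpan_le hUW hWu n)
    obtain ⟨f', U', h1, h2, h3, h4, h5⟩ := hs.exists_advance_ge hfg le_rfl
    refine ⟨f', U', h1, h2, h4, h5.resolve_left fun h6 => h4.not_inv ?_⟩
    rw [le_antisymm h3 h6]
    exact map_iSup_growSpan_le u U
  have step : ∀ v, ∀ k f U, IsStage u a v f U → True → ∃ f' U', (∀ z ∈ U, f' z = f z) ∧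
      U ⊔ U.map u ≤ U' ∧ t k ∈ U' ∧ IsStage u a v f' U' ∧ True := by
    intro v k f U hs _
    obtain ⟨f₁, U₁, h1, h2, h3, h4⟩ := close v f U hs
    set Y := U₁ ⊔ U₁.map u with hYdef
    have hYfg : Y.FG := h3.chain.fg.sup (h3.chain.fg.map u)
    have hUY : U ⊔ U.map u ≤ Y := sup_le_sup h2 (Submodule.map_mono h2)
    obtain ⟨x, hx, hx2⟩ := long hYfg h4
    obtain ⟨f₂, h5, h6⟩ := h3.exists_connect h4 hx
    have h7 : ∀ z ∈ U, f₂ z = f z := fun z hz => (h5 z (h2 hz)).trans (h1 z hz)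
    by_cases he : t k ∈ Y
    · exact ⟨f₂, _, h7, hUY.trans le_sup_left, Submodule.mem_sup_left he, h6, trivial⟩
    -- Here `t k` is an eigenvector modulo `Y` and cannot be connected directly. A long vector `x`
    -- is connected first; then `t k` is either met by advancing or inserted with a one-term orbit
    -- (`r = 0`).
    by_cases he' : u (t k) ∈ Y ⊔ Submodule.span F {t k}
    · set U₂ := Y ⊔ Submodule.span F {x} with hU₂
      have hYU₂ : Y ≤ U₂ := le_sup_left
      by_cases heW : t k ∈ ⨆ n, growSpan u U₂ n
      · obtain ⟨f₃, U₃, h8, h9, -, h10, h11⟩ := h6.exists_advance_ge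
          (Submodule.fg_span_singleton (t k)) ((Submodule.span_singleton_le_iff_mem _ _).2 heW)
        rcases h11 with h11 | h11
        · exact ⟨f₃, U₃, fun z hz => (h8 z (hYU₂ (hUY (Submodule.mem_sup_left hz)))).trans (h7 z hz),
            hUY.trans (hYU₂.trans h9), (Submodule.span_singleton_le_iff_mem _ _).1 h11, h10, trivial⟩
        -- The orbit closed before the stage reached `t k`; the closed space contains it, and one
        -- more connection restores non-invariance.
        · obtain ⟨x', hx', -⟩ := long (h10.chain.fg.sup (h10.chain.fg.map u)) h11
          obtain ⟨f₄, h12, h13⟩ := h10.exists_connect h11 hx'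
          have h14 : (⨆ n, growSpan u U₂ n) ≤ U₃ ⊔ U₃.map u :=
            iSup_le fun n => growSpan_le (h9.trans le_sup_left) h11 n
          exact ⟨f₄, _, fun z hz => (h12 z (h9 (hYU₂ (hUY (Submodule.mem_sup_left hz))))).trans
            ((h8 z (hYU₂ (hUY (Submodule.mem_sup_left hz)))).trans (h7 z hz)),
            hUY.trans (hYU₂.trans (h9.trans (le_sup_left.trans le_sup_left))),
            Submodule.mem_sup_left (h14 heW), h13, trivial⟩
      · obtain ⟨f₃, U₃, h8, h9, h10, h11⟩ := h6.exists_insert (r := 0) (e := t k)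
          (le_iSup (growSpan u U₂) 0) (map_iSup_growSpan_le u U₂) (by
            intro j hj
            obtain rfl : j = 0 := by omega
            rw [orbitSpan, sup_bot_eq, pow_zero]
            exact heW) (by
            rw [zero_add, pow_one, orbitSpan, orbitSpan, bot_sup_eq, pow_zero]
            exact sup_le_sup_right (hYU₂.trans le_sup_left) _ he') hx2
        exact ⟨f₃, U₃, fun z hz => (h8 z (hYU₂ (hUY (Submodule.mem_sup_left hz)))).trans (h7 z hz),
          hUY.trans (hYU₂.trans (le_sup_left.trans h9)), h10, h11, trivial⟩
    · obtain ⟨f₃, h8, h9⟩ := h3.exists_connect h4 he'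
      exact ⟨f₃, _, fun z hz => (h8 z (h2 hz)).trans (h1 z hz), hUY.trans le_sup_left,
        Submodule.mem_sup_right (Submodule.mem_span_singleton_self _), h9, trivial⟩
  obtain ⟨x, hx, -⟩ := long (Y := ⊥) Submodule.fg_bot (by simp)
  rw [bot_sup_eq] at hx
  obtain ⟨P, hP, -, -, htP, -⟩ := (IsStage.of_not_mem_span (a := a) hx).exists_cyclicPart
    (fun _ => True) t trivial (step x)
  have hPtop : P = ⊤ := by
    rw [← top_le_iff, ← ht, Submodule.span_le]
    rintro _ ⟨k, rfl⟩
    exact htP k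
  exact hPtop ▸ hP

end Torsion

/-! ### Countable dimension, `u` not torsion. -/

section Nontorsion

variable {F V : Type*} [Field F] [AddCommGroup V] [Module F V]

theorem not_fg_cyclicSpan {u : Module.End F V} {y : V}
    (hy : ∀ p : F[X], aeval u p y = 0 → p = 0) : ¬ (cyclicSpan u y).FG := by
  intro hfg
  let T : F[X] →ₗ[F] V := (LinearMap.applyₗ y).comp (aeval u).toLinearMap
  have hT : Function.Injective T := by
    rw [← LinearMap.ker_eq_bot, Submodule.eq_bot_iff]
    exact fun p hp => hy p hp
  have : Module.Finite F (LinearMap.range T) := Module.Finite.iff_fg.2 hfg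
  exact Polynomial.not_finite (R := F) (Module.Finite.equiv (LinearEquiv.ofInjective T hT).symm)

/-- A countable-dimensional space that is torsion modulo a free cyclic submodule can be made
cyclic. -/
theorem cyclicPart_top_of_torsion_mod {u : Module.End F V} (a : F) {y : V}
    (hy : ∀ p : F[X], aeval u p y = 0 → p = 0)
    (h : ∀ x, ∃ p : F[X], p ≠ 0 ∧ aeval u p x ∈ cyclicSpan u y)
    {t : ℕ → V} (ht : Submodule.span F (Set.range t) = ⊤) : CyclicPart u a ⊤ := by
  -- The free orbit of `y` prevents any stage starting at `y` from closing up, so connecting is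
  -- never needed.
  have hinv : ∀ G : Submodule F V, G.FG → y ∈ G → ¬ G.map u ≤ G := fun G hG hyG hGu =>
    not_fg_cyclicSpan hy (hG.of_le_of_field (cyclicSpan_le hGu hyG))
  have hgrow : ∀ G : Submodule F V, G.FG → ∀ n, (growSpan u G n).FG := by
    intro G hG n
    induction n with
    | zero => exact hG
    | succ n ih => exact ih.sup (ih.map u)
  have step : ∀ k f U, IsStage u a y f U → True → ∃ f' U', (∀ z ∈ U, f' z = f z) ∧
      U ⊔ U.map u ≤ U' ∧ t k ∈ U' ∧ IsStage u a y f' U' ∧ True := by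
    intro k f U hs _
    set W := ⨆ n, growSpan u U n with hW
    have hWu : W.map u ≤ W := map_iSup_growSpan_le u U
    have hUW : U ≤ W := le_iSup (growSpan u U) 0
    have hSW : U ⊔ U.map u ≤ W := le_iSup (growSpan u U) 1
    have hSfg : (U ⊔ U.map u).FG := hs.chain.fg.sup (hs.chain.fg.map u)
    have adv : ∀ w ∈ W, ∃ f' U', (∀ z ∈ U, f' z = f z) ∧ U ⊔ U.map u ≤ U' ∧ w ∈ U' ∧ U' ≤ W ∧
        IsStage u a y f' U' := by
      intro w hw
      obtain ⟨f', U', h1, h2, h3, h4, h5⟩ := hs.exists_advance_ge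
        (hSfg.sup (Submodule.fg_span_singleton w))
        (sup_le hSW ((Submodule.span_singleton_le_iff_mem _ _).2 hw))
      have h6 := h5.resolve_right (hinv _ (h4.chain.fg.sup (h4.chain.fg.map u))
        (Submodule.mem_sup_left h4.chain.mem))
      exact ⟨f', U', h1, le_sup_left.trans h6,
        h6 (Submodule.mem_sup_right (Submodule.mem_span_singleton_self w)), h3, h4⟩
    by_cases he : t k ∈ W
    · obtain ⟨f', U', h1, h2, h3, -, h4⟩ := adv _ he
      exact ⟨f', U', h1, h2, h3, h4, trivial⟩
    -- `t k` is torsion modulo `W`, which contains the orbit of `y`. The least such `j` is `r + 1`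
    -- in `exists_insert`; its relation involves some `w ∈ W`, which the stage must swallow
    -- beforehand.
    have hex : ∃ j, (u ^ j) (t k) ∈ W ⊔ orbitSpan u (t k) j := by
      obtain ⟨p, hp, hpW⟩ := h (t k)
      refine ⟨p.natDegree, ?_⟩
      have hpW' : aeval u p (t k) ∈ W := cyclicSpan_le hWu (hUW hs.chain.mem) hpW
      rw [aeval_eq_sum_range, Finset.sum_range_succ, LinearMap.add_apply, LinearMap.sum_apply] at hpW'
      have hlc : p.coeff p.natDegree ≠ 0 := by
        rw [coeff_natDegree]; exact leadingCoeff_ne_zero.2 hp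
      have hsum : ∑ i ∈ Finset.range p.natDegree, (p.coeff i • u ^ i) (t k) ∈
          orbitSpan u (t k) p.natDegree :=
        Submodule.sum_mem _ fun i hi => Submodule.smul_mem _ _
          (pow_apply_mem_orbitSpan u (t k) (Finset.mem_range.1 hi))
      have h1 := sub_mem (Submodule.mem_sup_left (T := orbitSpan u (t k) p.natDegree) hpW')
        (Submodule.mem_sup_right hsum)
      rw [add_sub_cancel_left] at h1
      exact (Submodule.smul_mem_iff _ hlc).1 h1
    classical
    obtain ⟨r, hr⟩ : ∃ r, Nat.find hex = r + 1 := by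
      refine Nat.exists_eq_succ_of_ne_zero fun h0 => he ?_
      have := Nat.find_spec hex
      rw [h0] at this
      simpa [orbitSpan] using this
    have hind : ∀ j < r + 1, (u ^ j) (t k) ∉ W ⊔ orbitSpan u (t k) j := fun j hj =>
      Nat.find_min hex (hr ▸ hj)
    have hrel := Nat.find_spec hex
    rw [hr] at hrel
    obtain ⟨w, hw, s, hs', hws⟩ := Submodule.mem_sup.1 hrel
    obtain ⟨f', U', h1, h2, h3, h4, h5⟩ := adv w hw
    obtain ⟨f'', U'', h6, h7, h8, h9⟩ := h5.exists_insert h4 hWu hind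
      (hws ▸ add_mem (Submodule.mem_sup_left (Submodule.mem_sup_left h3))
        (Submodule.mem_sup_right hs'))
      (hinv _ (hgrow U' h5.chain.fg 2) (Submodule.mem_sup_left (Submodule.mem_sup_left
        h5.chain.mem)))
    exact ⟨f'', U'', fun z hz => (h6 z (h2 (Submodule.mem_sup_left hz))).trans (h1 z hz),
      h2.trans (le_sup_left.trans h7), h8, h9, trivial⟩
  have hy1 : u y ∉ Submodule.span F {y} := by
    intro hcon
    refine hinv _ (Submodule.fg_span_singleton y) (Submodule.mem_span_singleton_self y) ?_
    rwa [Submodule.map_span, Set.image_singleton, Submodule.span_singleton_le_iff_mem]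
  obtain ⟨P, hP, -, -, htP, -⟩ := (IsStage.of_not_mem_span (a := a) hy1).exists_cyclicPart
    (fun _ => True) t trivial step
  have hPtop : P = ⊤ := by
    rw [← top_le_iff, ← ht, Submodule.span_le]
    rintro _ ⟨k, rfl⟩
    exact htP k
  exact hPtop ▸ hP

/-- Dictionary between `F[X]`-spans in `Module.AEval'` and sums of cyclic subspaces, for access to
maximal linearly independent families over `F[X]`. -/
theorem of_mem_span_iff {u : Module.End F V} {s : Set V} {z : V} :
    Module.AEval'.of u z ∈ Submodule.span F[X] (Module.AEval'.of u '' s) ↔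
      z ∈ ⨆ x ∈ s, cyclicSpan u x := by
  have hof : ∀ (p : F[X]) (x : V), p • Module.AEval'.of u x = Module.AEval'.of u (aeval u p x) :=
    fun p x => (Module.AEval.of_aeval_smul u p x).symm
  constructor
  · intro hz
    have key : ∀ w ∈ Submodule.span F[X] (Module.AEval'.of u '' s),
        (Module.AEval'.of u).symm w ∈ ⨆ x ∈ s, cyclicSpan u x := by
      intro w hw
      have hinv : (⨆ x ∈ s, cyclicSpan u x).map u ≤ ⨆ x ∈ s, cyclicSpan u x := by
        simp only [Submodule.map_iSup]
        exact iSup₂_mono fun x _ => map_cyclicSpan_le u x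
      induction hw using Submodule.span_induction with
      | mem w hw =>
        obtain ⟨x, hx, rfl⟩ := hw
        rw [LinearEquiv.symm_apply_apply]
        exact Submodule.mem_iSup_of_mem x (Submodule.mem_iSup_of_mem hx (self_mem_cyclicSpan u x))
      | zero => rw [map_zero]; exact zero_mem _
      | add w w' _ _ h h' => rw [map_add]; exact add_mem h h'
      | smul p w _ h =>
        obtain ⟨x, rfl⟩ := (Module.AEval'.of u).surjective w
        rw [hof, LinearEquiv.symm_apply_apply] at *
        exact aeval_apply_mem hinv h p
    simpa using key _ hz
  · intro hz
    have hle : (⨆ x ∈ s, cyclicSpan u x) ≤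
        ((Submodule.span F[X] (Module.AEval'.of u '' s)).restrictScalars F).comap
          (Module.AEval'.of u).toLinearMap := by
      refine iSup₂_le fun x hx => ?_
      rintro _ ⟨p, rfl⟩
      change Module.AEval'.of u (aeval u p x) ∈ Submodule.span F[X] (Module.AEval'.of u '' s)
      rw [← hof]
      exact Submodule.smul_mem _ _ (Submodule.subset_span ⟨x, hx, rfl⟩)
    exact hle hz

/-- A maximal family of vectors that is independent over the polynomials in `u`. -/
theorem exists_maximal_independent (u : Module.End F V) :
    ∃ s : Set V, (∀ y ∈ s, ∀ p : F[X], aeval u p y ∈ (⨆ x ∈ s \ {y}, cyclicSpan u x) → p = 0) ∧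
      ∀ z, ∃ p : F[X], p ≠ 0 ∧ aeval u p z ∈ ⨆ x ∈ s, cyclicSpan u x := by
  have hof : ∀ (p : F[X]) (x : V), p • Module.AEval'.of u x = Module.AEval'.of u (aeval u p x) :=
    fun p x => (Module.AEval.of_aeval_smul u p x).symm
  obtain ⟨s, hs, hmax⟩ := exists_maximal_linearIndepOn F[X] (fun x : V => Module.AEval'.of u x)
  refine ⟨s, fun y hy p hp => ?_, fun z => ?_⟩
  · refine hs.eq_zero_of_smul_mem_span hy p ?_
    rw [hof]
    exact of_mem_span_iff.2 hp
  · by_cases hz : z ∈ s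
    · refine ⟨1, one_ne_zero, ?_⟩
      rw [map_one, Module.End.one_apply]
      exact Submodule.mem_iSup_of_mem z (Submodule.mem_iSup_of_mem hz (self_mem_cyclicSpan u z))
    · obtain ⟨p, hp, hpz⟩ := hmax z hz
      refine ⟨p, hp, ?_⟩
      rw [hof] at hpz
      exact of_mem_span_iff.1 hpz

theorem isQuadraticSum_of_not_torsion (u : Module.End F V) (a b c : F) {y₀ : V}
    (hy₀ : ∀ p : F[X], aeval u p y₀ = 0 → p = 0)
    {t : ℕ → V} (ht : Submodule.span F (Set.range t) = ⊤) : IsQuadraticSum u a b c := by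
  obtain ⟨s, hs, hmax⟩ := exists_maximal_independent u
  obtain ⟨y, hy⟩ : s.Nonempty := by
    by_contra hne
    rw [Set.not_nonempty_iff_eq_empty] at hne
    obtain ⟨p, hp, hpy⟩ := hmax y₀
    rw [hne] at hpy
    exact hp (hy₀ p (by simpa using hpy))
  let ι := {x // x ∈ s \ {y}}
  classical
  let : LinearOrder ι := linearOrderOfSTO WellOrderingRel
  have : WellFoundedLT ι := ⟨(WellOrderingRel.isWellOrder (α := ι)).wf⟩
  let B : ι → Submodule F V := fun x => ⨆ z, ⨆ (_ : z ≤ x), cyclicSpan u (z : V)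
  -- The independent vectors other than `y` come first, each giving a free section with `f = 0`. The
  -- top section, `V` modulo their orbits, is torsion modulo the free orbit of `y`.
  let U : WithTop ι → Submodule F V := fun x => x.recTopCoe ⊤ B
  have hUtop : U ⊤ = ⊤ := rfl
  have hUcoe : ∀ x : ι, U x = B x := fun _ => rfl
  have hAcoe : ∀ x : ι, (⨆ j < (x : WithTop ι), U j) = ⨆ z, ⨆ (_ : z < x), cyclicSpan u (z : V) := by
    intro x
    apply le_antisymm
    · refine iSup₂_le fun j hj => ?_
      induction j using WithTop.recTopCoe with
      | top => exact absurd hj (not_lt_of_ge le_top)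
      | coe j =>
        rw [hUcoe]
        exact iSup₂_le fun z hz => le_iSup₂_of_le z (hz.trans_lt (WithTop.coe_lt_coe.1 hj)) le_rfl
    · refine iSup₂_le fun z hz => le_iSup₂_of_le (z : WithTop ι) (WithTop.coe_lt_coe.2 hz) ?_
      rw [hUcoe]
      exact le_iSup₂_of_le z le_rfl le_rfl
  have hAtop : (⨆ j < (⊤ : WithTop ι), U j) = ⨆ x ∈ s \ {y}, cyclicSpan u x := by
    rw [iSup_subtype' (p := fun x => x ∈ s \ {y})]
    apply le_antisymm
    · refine iSup₂_le fun j hj => ?_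
      induction j using WithTop.recTopCoe with
      | top => exact absurd hj (lt_irrefl _)
      | coe j =>
        rw [hUcoe]
        exact iSup₂_le fun z _ => le_iSup (fun z : ι => cyclicSpan u (z : V)) z
    · refine iSup_le fun z => le_iSup₂_of_le (z : WithTop ι) (WithTop.coe_lt_top z) ?_
      rw [hUcoe]
      exact le_iSup₂_of_le z le_rfl le_rfl
  have htorsion : ∀ (A : Submodule F V) (hA : A ≤ A.comap u) (x : V),
      (∀ p : F[X], aeval u p x ∈ A → p = 0) →
      ∀ p : F[X], aeval (A.mapQ A u hA) p (A.mkQ x) = 0 → p = 0 := by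
    intro A hA x hx p hp
    rw [aeval_mapQ_mkQ, Submodule.mkQ_apply, Submodule.Quotient.mk_eq_zero] at hp
    exact hx p hp
  refine isQuadraticSum_of_chain u a b c U (fun i => ?_)
    (top_le_iff.1 (hUtop ▸ le_iSup U ⊤))
  induction i using WithTop.recTopCoe with
  | top =>
    rw [hAtop, hUtop]
    set A := ⨆ x ∈ s \ {y}, cyclicSpan u x with hAdef
    have hA : A ≤ A.comap u := by
      rw [← Submodule.map_le_iff_le_comap, hAdef]
      simp only [Submodule.map_iSup]
      exact iSup₂_mono fun x _ => map_cyclicSpan_le u x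
    have h1 := cyclicPart_top_of_torsion_mod (u := A.mapQ A u hA) a (y := A.mkQ y)
      (htorsion A hA y (hs y hy)) (fun z => by
        obtain ⟨x, rfl⟩ := A.mkQ_surjective z
        obtain ⟨p, hp, hpx⟩ := hmax x
        refine ⟨p, hp, ?_⟩
        rw [aeval_mapQ_mkQ]
        have hle : (⨆ x ∈ s, cyclicSpan u x) ≤
            (cyclicSpan (A.mapQ A u hA) (A.mkQ y)).comap A.mkQ := by
          refine iSup₂_le fun x hx => ?_
          by_cases hxy : x = y
          · subst hxy
            rintro _ ⟨q, rfl⟩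
            exact ⟨q, aeval_mapQ_mkQ hA q x⟩
          · intro z hz
            have hzA : z ∈ A := Submodule.mem_iSup_of_mem x (Submodule.mem_iSup_of_mem ⟨hx, hxy⟩ hz)
            have h0 : A.mkQ z = 0 := (Submodule.Quotient.mk_eq_zero A).2 hzA
            rw [Submodule.mem_comap, h0]
            exact zero_mem _
        exact hle hpx) (t := fun n => A.mkQ (t n)) (by
        rw [Set.range_comp' A.mkQ t, ← Submodule.map_span, ht, Submodule.map_top,
          Submodule.range_mkQ])
    exact h1.cyclicSection hA le_top
  | coe x =>
    rw [hAcoe, hUcoe]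
    set A := ⨆ z, ⨆ (_ : z < x), cyclicSpan u (z : V) with hAdef
    have hA : A ≤ A.comap u := by
      rw [← Submodule.map_le_iff_le_comap, hAdef]
      simp only [Submodule.map_iSup]
      exact iSup₂_mono fun x _ => map_cyclicSpan_le u _
    have hB : B x = (cyclicSpan (A.mapQ A u hA) (A.mkQ x)).comap A.mkQ := by
      apply le_antisymm
      · refine iSup₂_le fun z hz => ?_
        rcases hz.eq_or_lt with rfl | hlt
        · rintro _ ⟨q, rfl⟩
          exact ⟨q, aeval_mapQ_mkQ hA q _⟩
        · intro w hw
          have hwA : w ∈ A := Submodule.mem_iSup_of_mem z (Submodule.mem_iSup_of_mem hlt hw)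
          have h0 : A.mkQ w = 0 := (Submodule.Quotient.mk_eq_zero A).2 hwA
          rw [Submodule.mem_comap, h0]
          exact zero_mem _
      · rintro z ⟨p, hp⟩
        have hp' : A.mkQ (aeval u p (x : V)) = A.mkQ z := by
          rw [← aeval_mapQ_mkQ hA]; exact hp
        have h1 : z - aeval u p (x : V) ∈ A := by
          rw [← Submodule.Quotient.mk_eq_zero, ← Submodule.mkQ_apply, map_sub, hp', sub_self]
        have hAB : A ≤ B x := iSup₂_le fun z hz => le_iSup₂_of_le z hz.le le_rfl
        have h2 : aeval u p (x : V) ∈ B x :=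
          Submodule.mem_iSup_of_mem x (Submodule.mem_iSup_of_mem le_rfl ⟨p, rfl⟩)
        have := add_mem (hAB h1) h2
        rwa [sub_add_cancel] at this
    rw [hB]
    refine CyclicPart.cyclicSection hA ⟨0, A.mkQ x, self_mem_cyclicSpan _ _, fun z _ => zero_mem _,
      fun z _ => by simp, fun z hz => ?_, ?_⟩ (map_cyclicSpan_le _ _)
    · obtain ⟨p, hp⟩ := mem_cyclicSpan.1 hz
      exact ⟨p, by rw [sub_zero, hp]⟩
    · refine not_fg_cyclicSpan (htorsion A hA x fun p hp => hs x x.2.1 p ?_)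
      refine (iSup₂_le fun z hz => ?_ : A ≤ _) hp
      exact le_iSup₂_of_le (z : V) ⟨z.2.1, fun h => hz.ne (Subtype.ext h)⟩ le_rfl

end Nontorsion

/-! ### Case distinction and reduction to polynomials `X (X - a)`. -/

section Main

variable {F V : Type*} [Field F] [AddCommGroup V] [Module F V]

theorem isQuadraticSum_of_torsion (u : Module.End F V) (a b c : F)
    (h : ∀ x, ∃ p : F[X], p ≠ 0 ∧ aeval u p x = 0) (hu : ∀ p : F[X], p ≠ 0 → aeval u p ≠ 0)
    {t : ℕ → V} (ht : Submodule.span F (Set.range t) = ⊤) : IsQuadraticSum u a b c := by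
  -- A chain with one term: its only section is `V / ⊥`, to which the torsion hypotheses are carried
  -- over.
  refine isQuadraticSum_of_chain (ι := Unit) u a b c (fun _ => ⊤) (fun i => ?_) (by simp)
  rw [show (⨆ j < i, (⊤ : Submodule F V)) = ⊥ by simp]
  have hA : (⊥ : Submodule F V) ≤ (⊥ : Submodule F V).comap u := bot_le
  have hpart := cyclicPart_top_of_torsion (u := (⊥ : Submodule F V).mapQ ⊥ u hA) a
    (t := fun n => (⊥ : Submodule F V).mkQ (t n)) (fun z => by
      obtain ⟨x, rfl⟩ := (⊥ : Submodule F V).mkQ_surjective z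
      obtain ⟨p, hp, hpx⟩ := h x
      exact ⟨p, hp, aeval_mapQ_eq_zero hA (by rw [hpx]; exact zero_mem _)⟩)
    (fun p hp h0 => hu p hp (LinearMap.ext fun x => by
      have hx := aeval_mapQ_mkQ hA p x
      rw [h0, LinearMap.zero_apply, Submodule.mkQ_apply] at hx
      exact (Submodule.mem_bot F).1 ((Submodule.Quotient.mk_eq_zero _).1 hx.symm)))
    (by rw [Set.range_comp' (⊥ : Submodule F V).mkQ t, ← Submodule.map_span, ht,
          Submodule.map_top, Submodule.range_mkQ])
  exact hpart.cyclicSection hA le_top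

theorem exists_span_range_eq_top_of_rank_le_aleph0 (hV : Module.rank F V ≤ Cardinal.aleph0) :
    ∃ t : ℕ → V, Submodule.span F (Set.range t) = ⊤ := by
  let B := Module.Basis.ofVectorSpace F V
  have hc : (insert 0 (Set.range B)).Countable := by
    refine Set.Countable.insert _ ?_
    rw [← Cardinal.le_aleph0_iff_set_countable, Cardinal.mk_range_eq B B.injective,
      B.mk_eq_rank'']
    exact hV
  obtain ⟨t, ht⟩ := hc.exists_eq_range ⟨0, Set.mem_insert _ _⟩
  exact ⟨t, by rw [← ht, Submodule.span_insert_zero, B.span_eq]⟩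

/-- Over an infinite-dimensional space, an endomorphism without dominant eigenvalue is a sum of
three endomorphisms annihilated by `X ^ 2 - a X`, `X ^ 2 - b X` and `X ^ 2 - c X`. -/
theorem isQuadraticSum_of_not_isDominantEigenvalue (hV : ¬ FiniteDimensional F V)
    (u : Module.End F V) (hu : ¬ ∃ l : F, IsDominantEigenvalue u l) (a b c : F) :
    IsQuadraticSum u a b c := by
  have hrk : ∀ l : F, Module.rank F V ≤ LinearMap.rank (u - l • (LinearMap.id : V →ₗ[F] V)) :=
    fun l => not_lt.1 fun h => hu ⟨l, h⟩
  rcases lt_or_ge Cardinal.aleph0 (Module.rank F V) with hc | hc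
  · exact isQuadraticSum_of_aleph0_lt_rank u a b c hc hrk
  obtain ⟨t, ht⟩ := exists_span_range_eq_top_of_rank_le_aleph0 hc
  by_cases halg : ∃ p : F[X], p ≠ 0 ∧ aeval u p = 0
  · obtain ⟨p, hp, hpu⟩ := halg
    refine isQuadraticSum_of_aeval_eq_zero u a b c hp hpu (fun l hl => ?_) t ht
    have hfin : Module.rank F (LinearMap.range (u - l • (LinearMap.id : V →ₗ[F] V)))
        < Cardinal.aleph0 :=
      Module.rank_lt_aleph0_iff.2 (Module.Finite.iff_fg.2 hl)
    exact hV (Module.rank_lt_aleph0_iff.1 ((hrk l).trans_lt hfin))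
  by_cases htor : ∀ x, ∃ p : F[X], p ≠ 0 ∧ aeval u p x = 0
  · exact isQuadraticSum_of_torsion u a b c htor (fun p hp h0 => halg ⟨p, hp, h0⟩) ht
  · push Not at htor
    obtain ⟨y, hy⟩ := htor
    exact isQuadraticSum_of_not_torsion u a b c
      (fun p hp => by_contra fun h0 => hy p h0 hp) ht

theorem exists_eq_C_mul_of_degree_eq_two {p : F[X]} (hdeg : p.degree = 2) (hp : p.Splits) :
    ∃ k x y : F, p = C k * ((X - C x) * (X - C y)) := by
  have hcard : p.roots.card = 2 := by
    rw [← hp.natDegree_eq_card_roots]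
    exact natDegree_eq_of_degree_eq_some hdeg
  obtain ⟨x, y, hxy⟩ := Multiset.card_eq_two.1 hcard
  refine ⟨p.leadingCoeff, x, y, ?_⟩
  conv_lhs => rw [hp.eq_prod_roots, hxy]
  simp

theorem aeval_add_algebraMap_eq_zero {f : Module.End F V} {k x y : F}
    (hf : f * f = (y - x) • f) :
    aeval (f + algebraMap F _ x) (C k * ((X - C x) * (X - C y))) = 0 := by
  have h : aeval (f + algebraMap F (Module.End F V) x) ((X - C x) * (X - C y)) = 0 := by
    rw [map_mul, map_sub, map_sub, aeval_X, aeval_C, aeval_C, add_sub_cancel_right, add_sub_assoc,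
      mul_add, hf, ← map_sub, ← Algebra.commutes, ← Algebra.smul_def, ← add_smul,
      sub_add_sub_cancel, sub_self, zero_smul]
  rw [map_mul, h, mul_zero]

end Main

theorem theorem3 {F V : Type*} [Field F] [AddCommGroup V] [Module F V]
    (hV : ¬ FiniteDimensional F V)
    (u : Module.End F V) (hu : ¬ ∃ l : F, IsDominantEigenvalue u l)
    (p₁ p₂ p₃ : F[X])
    (hdeg₁ : p₁.degree = 2) (hdeg₂ : p₂.degree = 2) (hdeg₃ : p₃.degree = 2)
    (hsplit₁ : p₁.Splits) (hsplit₂ : p₂.Splits) (hsplit₃ : p₃.Splits) :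
    IsPolynomialSum ![p₁, p₂, p₃] u := by
  obtain ⟨k₁, x₁, y₁, rfl⟩ := exists_eq_C_mul_of_degree_eq_two hdeg₁ hsplit₁
  obtain ⟨k₂, x₂, y₂, rfl⟩ := exists_eq_C_mul_of_degree_eq_two hdeg₂ hsplit₂
  obtain ⟨k₃, x₃, y₃, rfl⟩ := exists_eq_C_mul_of_degree_eq_two hdeg₃ hsplit₃
  -- Subtracting one root `x` from each summand turns `(X - x) (X - y)` into `X (X - (y - x))`; the
  -- scalar shift of `u` only translates its possible dominant eigenvalues.
  obtain ⟨f, g, h, hfgh, hf, hg, hh⟩ := isQuadraticSum_of_not_isDominantEigenvalue hV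
    (u - (x₁ + x₂ + x₃) • (LinearMap.id : V →ₗ[F] V)) (fun ⟨l, hl⟩ => hu ⟨x₁ + x₂ + x₃ + l, by
      rwa [IsDominantEigenvalue, sub_sub, ← add_smul] at hl⟩)
    (y₁ - x₁) (y₂ - x₂) (y₃ - x₃)
  refine ⟨![f + algebraMap F _ x₁, g + algebraMap F _ x₂, h + algebraMap F _ x₃], ?_, ?_⟩
  · have hid : (x₁ + x₂ + x₃) • (LinearMap.id : V →ₗ[F] V) =
        algebraMap F (Module.End F V) (x₁ + x₂ + x₃) := rfl
    rw [Fin.sum_univ_three, eq_add_of_sub_eq hfgh, hid, map_add, map_add]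
    simp only [Matrix.cons_val]
    abel
  · intro i
    fin_cases i
    · exact aeval_add_algebraMap_eq_zero hf
    · exact aeval_add_algebraMap_eq_zero hg
    · exact aeval_add_algebraMap_eq_zero hh
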